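/- **Setting.** Let $X=(X_n)_{n\ge 0}$ be an irreducible Markov chain on a finite set $\mathcal S$ with transition matrix $K$, and let $((\xi_n,\eta_n))_{n\ge1}$ be i.i.d. pairs of real random variables, independent of $X$ ($\xi_n$ and $\eta_n$ may be dependent). Let $\gamma(x,\cdot)$ and $\lambda(x,\cdot)\ge 0$ $(x\in\mathcal S)$ be measurable. For $\Delta>0$, $S_0=0$, $D_0=0$, $X_0=x_0$ put $S_{n+1}=S_n+\gamma(X_{n+1},\xi_{n+1})$, $D_{n+1}=D_n+\Delta\,\lambda(X_{n+1},\eta_{n+1})e^{S_{n+1}}$, $D_\infty=\lim_n D_n$, $T_\Delta=\inf\{n\ge0: D_n>1\}$ and $$\phi(\Delta)=P(D_\infty>1)=P(T_\Delta<\infty).$$ Let $\chi(x,\theta)=\log E e^{\theta\gamma(x,\xi_1)}$, $Q_\theta(x,y)=K(x,y)e^{\chi(y,\theta)}$, and let $e^{\psi(\theta)}$ be the Perron–Frobenius eigenvalue (spectral radius) of $Q_\theta$. **Assumptions.** 1. $\sup_{x,\ \theta\in\mathcal N}E e^{\theta\gamma(x,\xi_1)}<\infty$ for some neighbourhood $\mathcal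 N$ of $0$. 2. There is $\theta_*>0$ with $\psi(\theta_*)=0$, and $\psi(\theta)<\infty$ for some $\theta>\theta_*$. 3. $\sup_x E_x\lambda(X_1,\eta_1)^\alpha<\infty$ for every $\alpha\in(0,\infty)$, and the rewards are not a.s. zero: $P(\lambda(x,\eta_1)>0)>0$ for some $x\in\mathcal S$. For $\theta\in(0,\theta_*]$ fix strictly positive vectors $u_\theta$ with $Q_\theta u_\theta=e^{\psi(\theta)}u_\theta$, scaled so that $\theta\mapsto u_\theta(x)$ is left-continuous at $\theta_*$ for each $x$. **Constants.** Put $\rho_\Delta=1/\log(1/\Delta)$ and $\mu=\psi'(\theta_*)>0$. Let $b_0,b_1,b_2,B_1,B_2\in(0,\infty)$ be such that * $1/[\inf_{\theta\in(0,\theta_*),\,x\in\mathcal S}u_\theta(x)]^2\le b_0$; * $e^{\psi(\theta_*-\delta)}\le 1-\delta\mu+b_1\delta^2$ for all $\delta\in(0,\theta_*)$; * $\sup_{x\in\mathcal S,\ \delta\in(0,\theta_*)}E_x[\lambda(X_1,\eta_1)^{2\theta_*-\delta}e^{(\theta_*-\delta)\gamma(X_1,\xi_1)}]\le b_2$; *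 for all sufficiently small $\Delta>0$, $$\frac{b_0b_2\rho_\Delta}{B_2^{2\theta_*-\rho_\Delta}}+\frac{1-\rho_\Delta\mu+b_1\rho_\Delta^2}{(1-B_1\rho_\Delta)^{2\theta_*-\rho_\Delta}}\le 1 .$$ Put $c_\Delta=(B_2/B_1)\,\rho_\Delta^{-(1+1/(2\theta_*-\rho_\Delta))}$ and, for $d<1$, $$h_\Delta(s,d,x)=\min\Big\{\Big(c_\Delta e^{s}\frac{\Delta}{1-d}\Big)^{2\theta_*-\rho_\Delta}u_{\theta_*}(x)\,u_{\theta_*-\rho_\Delta}(x),\,1\Big\},$$ with $h_\Delta(s,d,x)=1$ for $d\ge1$. Let $C=\{h_\Delta<1\}$. **Algorithm.** Start at $(s,d,x)=(0,0,x_0)$ with $L=1$. At a state $(s,d,x)\in C$ draw $y$ from $K_{\theta_*}(x,y)=K(x,y)e^{\chi(y,\theta_*)-\psi(\theta_*)}u_{\theta_*}(y)/u_{\theta_*}(x)$, draw $z=\gamma(y,\xi)$ from the exponentially tilted law $e^{\theta_*z-\chi(y,\theta_*)}P(\gamma(y,\xi_1)\in dz)$, draw $w=\lambda(y,\eta)$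 from its nominal conditional law given $\gamma(y,\xi)=z$, and multiply $L$ by $e^{-\theta_*z}u_{\theta_*}(x)/u_{\theta_*}(y)$. At a state not in $C$ draw $(y,z,w)$ from the nominal law and leave $L$ unchanged. Then replace $(s,d,x)$ by $(s+z,\;d+\Delta w e^{s+z},\;y)$, and stop with output $L$ as soon as $d>1$. If the loop never stops, the output is $0$, i.e. the estimator is $L\,I(T_\Delta<\infty)$, denoted again by $L$. Write $E^{(r)}$ and $\mathrm{Var}^{(r)}$ for expectation and variance under the algorithm. **Theorem.** Under these assumptions, for every $x_0\in\mathcal S$: 1. (unbiasedness) $L$ is integrable and $E^{(r)}L=\phi(\Delta)$ for every $\Delta\in(0,1)$ with $\rho_\Delta<\theta_*$; 2. for all sufficiently small $\Delta>0$, $\phi(\Delta)>0$ and $E^{(r)}L^2<\infty$, and as $\Delta\searrow0$ $$\frac{E^{(r)}L^2}{\phi(\Delta)^2}=O\big(c_\Delta^{2\theta_*}\big),\qquad \frac{\sqrt{\mathrm{Var}^{(r)}L}}{E^{(r)}L}=O\big(c_\Delta^{2\theta_*}\big);$$ 3. (asymptotic optimality) for every $\varepsilon>0$, $E^{(r)}L^2=O\big(\phi(\Delta)^{2-\varepsilon}\big)$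 as $\Delta\searrow0$. -/

import Mathlib

open MeasureTheory ProbabilityTheory Filter Topology Asymptotics
open scoped ENNReal

noncomputable section

namespace Perpetuity

/-- A Markov-modulated perpetuity on a finite state space `S`: the modulating chain `X` has an
irreducible transition matrix `K`; the pairs `(ξ_n, η_n)` are i.i.d. with law `ν` on `ℝ × ℝ`
(no independence between `ξ_n` and `η_n` is assumed) and independent of `X`; the discount rates
are `γ(X_n, ξ_n)` and the non-negative reward rates are `lam(X_n, η_n)`. -/
structure Model (S : Type*) [Fintype S] where
  /-- transition matrix of the modulating chain -/
  K : Matrix S S ℝ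
  irreducible : K.IsIrreducible
  row_sum : ∀ x, ∑ y, K x y = 1
  /-- common law of the pairs `(ξ_n, η_n)` -/
  ν : Measure (ℝ × ℝ)
  isProb : IsProbabilityMeasure ν
  /-- discount rate function -/
  γ : S → ℝ → ℝ
  measurable_γ : ∀ x, Measurable (γ x)
  /-- reward rate function -/
  lam : S → ℝ → ℝ
  measurable_lam : ∀ x, Measurable (lam x)
  lam_nonneg : ∀ x z, 0 ≤ lam x z

attribute [instance] Model.isProb

/-- States `w = (s, d, x)` of the chain `W_n = (S_n, D_n, X_n)`. -/
abbrev State (S : Type*) := ℝ × ℝ × S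

/-- Law of the path `(W_0, W_1, …)` of the Markov chain with transition kernel `κ` started
at `w`. -/
def chainLaw {W : Type*} [MeasurableSpace W] (κ : Kernel W W) [IsMarkovKernel κ] (w : W) :
    Measure (ℕ → W) :=
  Kernel.traj (X := fun _ => W)
    (fun n => κ.comap (fun h : (Finset.Iic n) → W => h ⟨n, Finset.mem_Iic.2 le_rfl⟩)
      (measurable_pi_apply _)) 0 (fun _ => w)

instance {W : Type*} [MeasurableSpace W] (κ : Kernel W W) [IsMarkovKernel κ] (w : W) :
    IsProbabilityMeasure (chainLaw κ w) := by
  unfold chainLaw; infer_instance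

namespace Model

variable {S : Type*} [Fintype S] (M : Model S)

/-- `χ(x, θ) = log E exp(θ γ(x, ξ))`. -/
def χ (x : S) (θ : ℝ) : ℝ := cgf (fun e : ℝ × ℝ => M.γ x e.1) M.ν θ

/-- The matrix `Q_θ(x, y) = K(x, y) exp(χ(y, θ))`. -/
def Q (θ : ℝ) : Matrix S S ℝ := fun x y => M.K x y * Real.exp (M.χ y θ)

/-- `exp(ψ(θ))` is the Perron-Frobenius eigenvalue of `Q_θ`, i.e. its spectral radius. -/
def ψ [DecidableEq S] (θ : ℝ) : ℝ :=
  Real.log (spectralRadius ℂ ((M.Q θ).map (fun t : ℝ => (t : ℂ)))).toReal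

/-- `E exp(θ γ(x, ξ)) < ∞` for all `x`. As every state is entered with positive probability,
this says that `Q_θ` has finite entries, i.e. `ψ(θ) < ∞`. -/
def FinitePsi (θ : ℝ) : Prop :=
  ∀ x, Integrable (fun e : ℝ × ℝ => Real.exp (θ * M.γ x e.1)) M.ν

variable [MeasurableSpace S]

/-- Nominal law of `(X_1, (ξ_1, η_1))` given `X_0 = x`. -/
def nominalStep (x : S) : Measure (S × (ℝ × ℝ)) :=
  ∑ y, ENNReal.ofReal (M.K x y) • ((Measure.dirac y).prod M.ν)

/-- `sup_{x, θ ∈ N} E exp(θ γ(x, ξ)) < ∞` for a neighbourhood `N` of the origin. -/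
def DiscountMoments : Prop :=
  ∃ N ∈ 𝓝 (0 : ℝ),
    (⨆ x, ⨆ θ ∈ N, ∫⁻ e, ENNReal.ofReal (Real.exp (θ * M.γ x e.1)) ∂M.ν) < ∞

/-- `sup_x E_x[lam(X_1, η_1)^α] < ∞` for every `α ∈ (0, ∞)`. -/
def RewardMoments : Prop :=
  ∀ α : ℝ, 0 < α →
    (⨆ x, ∫⁻ p, ENNReal.ofReal (M.lam p.1 p.2.2 ^ α) ∂(M.nominalStep x)) < ∞

/-- The rewards are not almost surely zero. -/
def RewardsNontrivial : Prop := ∃ x, 0 < M.ν {e | 0 < M.lam x e.2}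

/-- New state `(s + z, d + Δ w exp(s + z), y)`, where `z = γ(y, ξ)` and `w = lam(y, η)`. -/
def update (Δ : ℝ) (p : State S × (S × (ℝ × ℝ))) : State S :=
  (p.1.1 + M.γ p.2.1 p.2.2.1,
    p.1.2.1 + Δ * M.lam p.2.1 p.2.2.2 * Real.exp (p.1.1 + M.γ p.2.1 p.2.2.1),
    p.2.1)

variable [MeasurableSingletonClass S]

instance nominalStep_prob (x : S) : IsProbabilityMeasure (M.nominalStep x) := by
  constructor
  simp only [nominalStep, Measure.coe_finsetSum, Finset.sum_apply, Measure.smul_apply,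
    measure_univ, smul_eq_mul, mul_one]
  rw [← ENNReal.ofReal_sum_of_nonneg (fun y _ => M.irreducible.nonneg x y), M.row_sum,
    ENNReal.ofReal_one]

/-- The nominal step as a kernel. -/
def nominalKernel : Kernel S (S × (ℝ × ℝ)) := Kernel.ofFunOfCountable M.nominalStep

instance : IsMarkovKernel M.nominalKernel := ⟨fun x => M.nominalStep_prob x⟩

lemma measurable_update (Δ : ℝ) : Measurable (M.update Δ) := by
  have h1 : Measurable fun p : State S × (S × (ℝ × ℝ)) => M.γ p.2.1 p.2.2.1 :=
    (measurable_from_prod_countable_right (f := fun q : S × ℝ => M.γ q.1 q.2)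
      M.measurable_γ).comp (by fun_prop : Measurable
        fun p : State S × (S × (ℝ × ℝ)) => (p.2.1, p.2.2.1))
  have h2 : Measurable fun p : State S × (S × (ℝ × ℝ)) => M.lam p.2.1 p.2.2.2 :=
    (measurable_from_prod_countable_right (f := fun q : S × ℝ => M.lam q.1 q.2)
      M.measurable_lam).comp (by fun_prop : Measurable
        fun p : State S × (S × (ℝ × ℝ)) => (p.2.1, p.2.2.2))
  unfold update
  fun_prop

/-- The nominal transition kernel of `W_n = (S_n, D_n, X_n)`. -/
def transition (Δ : ℝ) : Kernel (State S) (State S) :=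
  ((Kernel.id (α := State S)) ×ₖ
    (M.nominalKernel.comap (fun w : State S => w.2.2) (by fun_prop))).map (M.update Δ)

instance (Δ : ℝ) : IsMarkovKernel (M.transition Δ) :=
  Kernel.IsMarkovKernel.map _ (M.measurable_update Δ)

/-- The limit `D_∞` of `D_n` along a path (`D_n` is non-decreasing in `n`). -/
def Dinf (ω : ℕ → State S) : EReal := ⨆ n, ((ω n).2.1 : EReal)

/-- `φ(Δ) = P(D_∞ > 1 | S_0 = 0, D_0 = 0, X_0 = x₀)`. -/
def φ (x₀ : S) (Δ : ℝ) : ℝ :=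
  (chainLaw (M.transition Δ) ((0, 0, x₀) : State S)).real {ω | 1 < Dinf ω}

end Model

/-- Cramér's condition with root `θs = θ_*`, together with a choice of strictly positive Perron
eigenvectors `u_θ` of `Q_θ` (which are unique only up to scaling). -/
structure Cramer {S : Type*} [Fintype S] [DecidableEq S] (M : Model S) where
  θs : ℝ
  pos : 0 < θs
  psi_root : M.ψ θs = 0
  finite_beyond : ∃ θ, θs < θ ∧ M.FinitePsi θ
  u : ℝ → S → ℝ
  u_pos : ∀ θ ∈ Set.Ioc 0 θs, ∀ x, 0 < u θ x
  eigen : ∀ θ ∈ Set.Ioc 0 θs, (M.Q θ).mulVec (u θ) = Real.exp (M.ψ θ) • u θ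

/-- `ρ_Δ = 1 / log(1/Δ)`. -/
def rho (Δ : ℝ) : ℝ := 1 / Real.log (1 / Δ)

namespace Cramer

variable {S : Type*} [Fintype S] [DecidableEq S] {M : Model S} (T : Cramer M)

lemma finite_root : M.FinitePsi T.θs := by
  obtain ⟨θ, hθ, hfin⟩ := T.finite_beyond
  intro x
  have hγ : Measurable fun e : ℝ × ℝ => M.γ x e.1 := (M.measurable_γ x).comp measurable_fst
  refine ((integrable_const (1 : ℝ)).add (hfin x)).mono'
    (hγ.const_mul T.θs).exp.aestronglyMeasurable (ae_of_all _ fun e => ?_)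
  rw [Real.norm_eq_abs, abs_of_pos (Real.exp_pos _)]
  simp only [Pi.add_apply]
  rcases le_total (M.γ x e.1) 0 with h | h
  · have : Real.exp (T.θs * M.γ x e.1) ≤ 1 :=
      Real.exp_le_one_iff.2 (mul_nonpos_of_nonneg_of_nonpos T.pos.le h)
    linarith [Real.exp_pos (θ * M.γ x e.1)]
  · have : Real.exp (T.θs * M.γ x e.1) ≤ Real.exp (θ * M.γ x e.1) :=
      Real.exp_le_exp.2 (mul_le_mul_of_nonneg_right hθ.le h)
    linarith

/-- The tilted transition matrix
`K_{θ_*}(x, y) = K(x, y) exp(χ(y, θ_*) - ψ(θ_*)) u_{θ_*}(y) / u_{θ_*}(x)`. -/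
def tiltedK (x y : S) : ℝ :=
  M.K x y * Real.exp (M.χ y T.θs - M.ψ T.θs) * (T.u T.θs y / T.u T.θs x)

lemma tiltedK_nonneg (x y : S) : 0 ≤ T.tiltedK x y := by
  have hm : T.θs ∈ Set.Ioc 0 T.θs := ⟨T.pos, le_rfl⟩
  have := M.irreducible.nonneg x y
  have := T.u_pos _ hm x
  have := T.u_pos _ hm y
  unfold tiltedK
  positivity

lemma tiltedK_row_sum (x : S) : ∑ y, T.tiltedK x y = 1 := by
  have hm : T.θs ∈ Set.Ioc 0 T.θs := ⟨T.pos, le_rfl⟩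
  have hx := T.u_pos _ hm x
  have h := congrFun (T.eigen _ hm) x
  simp only [Matrix.mulVec, dotProduct, Model.Q, T.psi_root, Real.exp_zero, one_smul] at h
  simp only [tiltedK, T.psi_root, sub_zero, ← mul_div_assoc]
  rw [← Finset.sum_div, h, div_self hx.ne']

/-- The constant `c_Δ = (B₂/B₁) ρ_Δ^{-(1 + 1/(2θ_* - ρ_Δ))}`. -/
def c (B₁ B₂ Δ : ℝ) : ℝ := B₂ / B₁ * rho Δ ^ (-(1 + 1 / (2 * T.θs - rho Δ)))

/-- The function `h_Δ(s, d, x)`, equal to `1` for `d ≥ 1` (there `Δ/(1-d)_+ = +∞`). -/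
def h (B₁ B₂ Δ : ℝ) (w : State S) : ℝ :=
  if w.2.1 < 1 then
    min (T.c B₁ B₂ Δ ^ (2 * T.θs - rho Δ) * Real.exp ((2 * T.θs - rho Δ) * w.1)
      * (Δ / (1 - w.2.1)) ^ (2 * T.θs - rho Δ) * (T.u T.θs w.2.2 * T.u (T.θs - rho Δ) w.2.2)) 1
  else 1

/-- The region `C = {h_Δ < 1}` where importance sampling is applied. -/
def C (B₁ B₂ Δ : ℝ) : Set (State S) := {w | T.h B₁ B₂ Δ w < 1}

open scoped Classical in
/-- One-step likelihood ratio `r(w₀, w₁)` of the nominal kernel with respect to the sampler. -/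
def r (B₁ B₂ Δ : ℝ) (w₀ w₁ : State S) : ℝ :=
  if w₀ ∈ T.C B₁ B₂ Δ then
    Real.exp (-T.θs * (w₁.1 - w₀.1)) * (T.u T.θs w₀.2.2 / T.u T.θs w₁.2.2)
  else 1

open scoped Classical in
/-- The output of the algorithm: the accumulated likelihood ratio up to
`T_Δ = inf {n : D_n > 1}`, and `0` if the loop never stops. -/
def L (B₁ B₂ Δ : ℝ) (ω : ℕ → State S) : ℝ :=
  if ∃ n, 1 < (ω n).2.1 then
    ∏ k ∈ Finset.range (sInf {n | 1 < (ω n).2.1}), T.r B₁ B₂ Δ (ω k) (ω (k + 1))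
  else 0

variable [MeasurableSpace S]

/-- Tilted law of `(X_1, (ξ_1, η_1))` given `X_0 = x`: first `X_1 = y` is drawn from
`K_{θ_*}(x, ·)`, then `(ξ, η)` is drawn from the law with density
`exp(θ_* γ(y, ξ) - χ(y, θ_*))` with respect to `ν`. Thus `γ(y, ξ)` is exponentially tilted, and
given `γ(y, ξ)` the reward `lam(y, η)` keeps its nominal conditional law. -/
def tiltedStep (x : S) : Measure (S × (ℝ × ℝ)) :=
  ∑ y, ENNReal.ofReal (T.tiltedK x y) •
    ((Measure.dirac y).prod (M.ν.tilted fun e => T.θs * M.γ y e.1))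

instance tilted_prob (y : S) :
    IsProbabilityMeasure (M.ν.tilted fun e => T.θs * M.γ y e.1) :=
  isProbabilityMeasure_tilted (T.finite_root y)

instance tiltedStep_prob (x : S) : IsProbabilityMeasure (T.tiltedStep x) := by
  constructor
  have hp := T.tilted_prob
  simp only [tiltedStep, Measure.coe_finsetSum, Finset.sum_apply, Measure.smul_apply,
    measure_univ, smul_eq_mul, mul_one]
  rw [← ENNReal.ofReal_sum_of_nonneg (fun y _ => T.tiltedK_nonneg x y), T.tiltedK_row_sum,
    ENNReal.ofReal_one]

variable [MeasurableSingletonClass S]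

/-- The tilted step as a kernel. -/
def tiltedKernel : Kernel S (S × (ℝ × ℝ)) := Kernel.ofFunOfCountable T.tiltedStep

instance : IsMarkovKernel T.tiltedKernel := ⟨fun x => T.tiltedStep_prob x⟩

lemma measurableSet_C (B₁ B₂ Δ : ℝ) : MeasurableSet (T.C B₁ B₂ Δ) := by
  have hu (θ : ℝ) : Measurable fun w : State S => T.u θ w.2.2 :=
    (measurable_of_finite (T.u θ)).comp (by fun_prop)
  have h1 := hu T.θs
  have h2 := hu (T.θs - rho Δ)
  have : Measurable (T.h B₁ B₂ Δ) := by
    unfold h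
    refine Measurable.ite (measurableSet_lt (by fun_prop) (by fun_prop)) ?_ measurable_const
    fun_prop
  exact measurableSet_lt this measurable_const

open scoped Classical in
/-- The transition kernel of `W` under the state-dependent sampler: tilted steps from states
in `C`, nominal steps from the other states. -/
def sampler (B₁ B₂ Δ : ℝ) : Kernel (State S) (State S) :=
  ((Kernel.id (α := State S)) ×ₖ
    (Kernel.piecewise (T.measurableSet_C B₁ B₂ Δ)
      (T.tiltedKernel.comap (fun w : State S => w.2.2) (by fun_prop))
      (M.nominalKernel.comap (fun w : State S => w.2.2) (by fun_prop)))).map (M.update Δ)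

instance (B₁ B₂ Δ : ℝ) : IsMarkovKernel (T.sampler B₁ B₂ Δ) :=
  Kernel.IsMarkovKernel.map _ (M.measurable_update Δ)

/-- Path law of the sampler started at `(0, 0, x₀)`. -/
def samplerLaw (B₁ B₂ : ℝ) (x₀ : S) (Δ : ℝ) : Measure (ℕ → State S) :=
  chainLaw (T.sampler B₁ B₂ Δ) ((0, 0, x₀) : State S)

/-- Admissible constants of the algorithm, with auxiliary `b₀, b₁, b₂` and `μ = ψ'(θ_*)`. -/
structure Admissible (b₀ b₁ b₂ B₁ B₂ : ℝ) : Prop where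
  slope_pos : 0 < deriv M.ψ T.θs
  b₀_pos : 0 < b₀
  /-- `1 / (inf_{θ ∈ (0, θ_*), x} u_θ(x))² ≤ b₀` -/
  b₀_bound : ∀ θ ∈ Set.Ioo 0 T.θs, ∀ x, 1 / T.u θ x ^ 2 ≤ b₀
  b₁_pos : 0 < b₁
  b₁_bound : ∀ δ ∈ Set.Ioo 0 T.θs,
    Real.exp (M.ψ (T.θs - δ)) ≤ 1 - δ * deriv M.ψ T.θs + b₁ * δ ^ 2
  b₂_pos : 0 < b₂
  b₂_bound : ∀ x, ∀ δ ∈ Set.Ioo 0 T.θs,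
    ∫⁻ p, ENNReal.ofReal (M.lam p.1 p.2.2 ^ (2 * T.θs - δ)
      * Real.exp ((T.θs - δ) * M.γ p.1 p.2.1)) ∂(M.nominalStep x) ≤ ENNReal.ofReal b₂
  B₁_pos : 0 < B₁
  B₂_pos : 0 < B₂
  main_bound : ∀ᶠ Δ in 𝓝[>] (0 : ℝ),
    b₀ * b₂ * rho Δ / B₂ ^ (2 * T.θs - rho Δ)
      + (1 - rho Δ * deriv M.ψ T.θs + b₁ * rho Δ ^ 2)
        / (1 - B₁ * rho Δ) ^ (2 * T.θs - rho Δ) ≤ 1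

end Cramer

/-- Coefficient of variation: standard deviation divided by the mean. -/
def coeffVar {Ω : Type*} [MeasurableSpace Ω] (Z : Ω → ℝ) (P : Measure Ω) : ℝ :=
  Real.sqrt (variance Z P) / ∫ ω, Z ω ∂P

end Perpetuity

end

noncomputable section

/-! Each expectation is the mean of a product of one-step weights up to ruin. By the Markov property
it is a series of iterates of a killed weighted step operator (`lintegral_hitWeight`), so it depends
on the sampler only through one-step integrals. One factor of the likelihood ratio turns a sampler
step into a nominal step (`lintegral_r_mul_sampler`). Hence the mean of `L` is the nominal ruin
probability. The second moment, which carries two factors, is the nominal mean of the product of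
likelihood ratios up to ruin (`lintegral_L_sq`).

Upper bound. A function that is at least 1 on ruin and superharmonic for the weighted nominal step
dominates the second moment (`hitValue_le`). The function `h` qualifies. Off `C` it equals its
maximum 1 and the weight is 1. In `C` a step either uses a small fraction of the remaining distance
to 1, and the eigenvalue of Q at θ_* − ρ gives a contraction, or it earns a large reward, which the
reward moment `b₂` controls (`lyapunov_of_mem`). Evaluation at the start gives order c^{2θ_*}
Δ^{2θ_*}, since Δ^{-ρ} = e.

Lower bound: φ(Δ) ≥ k Δ^{θ_*}. By irreducibility, ruin has probability bounded below once Δ e^s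
exceeds a constant. It remains to bound the chance of climbing to s near log(1/Δ). The function
e^{θ_* t} u(x) is harmonic but unbounded. Cutting it off above a level a loses an overshoot term of
order e^{-εa}, made small by a finite exponential moment beyond θ_*. Damping it by a concave
function of Z = e^{-δt} v/u, with v an eigenvector at θ_* − δ, gains strictly, because the tilted
mean of Z contracts by e^{ψ(θ_* − δ)} < 1. The resulting `barrier` is subharmonic below 0
(`barrier_le_lintegral`) and bounds the ruin probability from below (`le_ruinProb`).

The ratio of the two bounds is of order c^{2θ_*}. Since c is at most a power of log(1/Δ), it costs
less than any power of φ. -/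

namespace Perpetuity

/-! ### Expected weights accumulated up to a hitting time -/

section Chain

variable {W : Type*}

open scoped Classical in
/-- Weights accumulated until the first visit to `A`; `0` on paths that never visit `A`. -/
def hitWeight (r : W → W → ℝ≥0∞) (A : Set W) (ω : ℕ → W) : ℝ≥0∞ :=
  if ∃ n, ω n ∈ A then ∏ k ∈ Finset.range (sInf {n | ω n ∈ A}), r (ω k) (ω (k + 1)) else 0

/-- The weight `r(w, w')`, killed on `A`. -/
def killed (r : W → W → ℝ≥0∞) (A : Set W) (w w' : W) : ℝ≥0∞ := Aᶜ.indicator (fun w => r w w') w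

/-- Only the term at the first hitting time survives: earlier indicators vanish, and later products
contain a killed factor. -/
lemma hitWeight_eq_tsum (r : W → W → ℝ≥0∞) (A : Set W) (ω : ℕ → W) :
    hitWeight r A ω = ∑' n, (∏ k ∈ Finset.range n, killed r A (ω k) (ω (k + 1)))
      * A.indicator (1 : W → ℝ≥0∞) (ω n) := by
  classical
  unfold hitWeight
  split_ifs with h
  · set N := sInf {n | ω n ∈ A} with hN
    have hNA : ω N ∈ A := Nat.sInf_mem (s := {n | ω n ∈ A}) h
    have hlt : ∀ k < N, ω k ∉ A := fun k hk => Nat.notMem_of_lt_sInf (s := {n | ω n ∈ A}) hk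
    rw [tsum_eq_single N]
    · rw [Set.indicator_of_mem hNA, Pi.one_apply, mul_one]
      refine Finset.prod_congr rfl fun k hk => ?_
      rw [killed, Set.indicator_of_mem (hlt k (Finset.mem_range.1 hk))]
    · intro n hn
      rcases lt_or_gt_of_ne hn with h1 | h1
      · rw [Set.indicator_of_notMem (hlt n h1), mul_zero]
      · rw [Finset.prod_eq_zero (Finset.mem_range.2 h1), zero_mul]
        rw [killed, Set.indicator_of_notMem (by simpa using hNA)]
  · push Not at h
    simp [Set.indicator_of_notMem (h _)]

variable [MeasurableSpace W] (κ : Kernel W W)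

/-- The weighted one-step operator `f ↦ ∫ r(w, w') f(w') κ(w, dw')`. -/
def weightedStep (r : W → W → ℝ≥0∞) (f : W → ℝ≥0∞) (w : W) : ℝ≥0∞ :=
  ∫⁻ w', r w w' * f w' ∂(κ w)

lemma weightedStep_mono (r : W → W → ℝ≥0∞) {f g : W → ℝ≥0∞} (h : ∀ w, f w ≤ g w) (w : W) :
    weightedStep κ r f w ≤ weightedStep κ r g w :=
  lintegral_mono fun w' => mul_le_mul_right (h w') _

/-- Expected accumulated weight until the first visit to `A`, in terms of the step operator. -/
def hitValue (r : W → W → ℝ≥0∞) (A : Set W) (w : W) : ℝ≥0∞ :=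
  ∑' n, (weightedStep κ (killed r A))^[n] (A.indicator 1) w

variable [IsMarkovKernel κ]

/-- Markov property of `chainLaw` at time `n`. -/
lemma lintegral_chainLaw_succ (w : W) (n : ℕ) (G : (Finset.Iic n → W) → ℝ≥0∞) (hG : Measurable G)
    (F : W → W → ℝ≥0∞) (hF : Measurable (Function.uncurry F)) :
    ∫⁻ ω, G (Preorder.frestrictLe (π := fun _ => W) n ω) * F (ω n) (ω (n + 1)) ∂(chainLaw κ w) =
      ∫⁻ ω, G (Preorder.frestrictLe (π := fun _ => W) n ω) * ∫⁻ w', F (ω n) w' ∂(κ (ω n))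
        ∂(chainLaw κ w) := by
  set κ' : (n : ℕ) → Kernel (Finset.Iic n → W) W := fun n =>
    κ.comap (fun h : (Finset.Iic n) → W => h ⟨n, Finset.mem_Iic.2 le_rfl⟩)
      (measurable_pi_apply _) with hκ'
  -- Disintegration: the past up to time n, followed by the path law given that past. Coordinate n +
  -- 1 of the latter has law κ at the current state.
  have key := Kernel.partialTraj_compProd_traj (X := fun _ => W) (κ := κ') (Nat.zero_le n)
    (fun _ => w)
  have hF' : Measurable fun w₀ => ∫⁻ w', F w₀ w' ∂(κ w₀) :=
    Measurable.lintegral_kernel_prod_right hF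
  have hH : Measurable fun p : (Finset.Iic n → W) × (ℕ → W) =>
      G p.1 * F (p.1 ⟨n, Finset.mem_Iic.2 le_rfl⟩) (p.2 (n + 1)) :=
    (hG.comp measurable_fst).mul (hF.comp (by fun_prop : Measurable
      fun p : (Finset.Iic n → W) × (ℕ → W) => (p.1 ⟨n, Finset.mem_Iic.2 le_rfl⟩, p.2 (n + 1))))
  have hm : Measurable (fun ω : ℕ → W => (Preorder.frestrictLe (π := fun _ => W) n ω, ω)) := by
    fun_prop
  have e1 : ∫⁻ ω, G (Preorder.frestrictLe (π := fun _ => W) n ω) * F (ω n) (ω (n + 1))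
      ∂(chainLaw κ w) = ∫⁻ p, G p.1 * F (p.1 ⟨n, Finset.mem_Iic.2 le_rfl⟩) (p.2 (n + 1))
        ∂((chainLaw κ w).map fun ω => (Preorder.frestrictLe (π := fun _ => W) n ω, ω)) := by
    rw [lintegral_map hH hm]
    rfl
  have e2 : ((chainLaw κ w).map fun ω => (Preorder.frestrictLe (π := fun _ => W) n ω, ω)) =
      (Kernel.partialTraj (X := fun _ => W) κ' 0 n (fun _ => w)) ⊗ₘ
        (Kernel.traj (X := fun _ => W) κ' n) := key.symm
  rw [e1, e2, Measure.lintegral_compProd hH]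
  have e3 : ∫⁻ ω, G (Preorder.frestrictLe (π := fun _ => W) n ω) * ∫⁻ w', F (ω n) w' ∂(κ (ω n))
      ∂(chainLaw κ w) = ∫⁻ h, G h * ∫⁻ w', F (h ⟨n, Finset.mem_Iic.2 le_rfl⟩) w'
        ∂(κ (h ⟨n, Finset.mem_Iic.2 le_rfl⟩))
        ∂((chainLaw κ w).map (Preorder.frestrictLe (π := fun _ => W) n)) := by
    have hm' : Measurable fun h : Finset.Iic n → W =>
        G h * ∫⁻ w', F (h ⟨n, Finset.mem_Iic.2 le_rfl⟩) w'
          ∂(κ (h ⟨n, Finset.mem_Iic.2 le_rfl⟩)) :=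
      hG.mul (hF'.comp (measurable_pi_apply _))
    exact (lintegral_map hm' (Preorder.measurable_frestrictLe (X := fun _ => W) n)).symm
  have e4 : (chainLaw κ w).map (Preorder.frestrictLe (π := fun _ => W) n) =
      Kernel.partialTraj (X := fun _ => W) κ' 0 n (fun _ => w) :=
    Kernel.traj_map_frestrictLe_apply (X := fun _ => W) (κ := κ') 0 n (fun _ => w)
  rw [e3, e4]
  refine lintegral_congr fun h => ?_
  have hFh : Measurable (F (h ⟨n, Finset.mem_Iic.2 le_rfl⟩)) :=
    hF.comp (by fun_prop : Measurable fun w' => (h ⟨n, Finset.mem_Iic.2 le_rfl⟩, w'))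
  have hFn : Measurable fun ω : ℕ → W => F (h ⟨n, Finset.mem_Iic.2 le_rfl⟩) (ω (n + 1)) :=
    hFh.comp (measurable_pi_apply (n + 1))
  have e5 : (Kernel.traj (X := fun _ => W) κ' n h).map (fun ω : ℕ → W => ω (n + 1)) = κ' n h := by
    rw [← Kernel.map_apply _ (measurable_pi_apply (n + 1)), Kernel.map_traj_succ_self]
  have e6 : κ' n h = κ (h ⟨n, Finset.mem_Iic.2 le_rfl⟩) := Kernel.comap_apply _ _ _
  rw [← e6, ← e5, lintegral_map hFh (measurable_pi_apply (n + 1))]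
  exact lintegral_const_mul (G h) hFn

lemma lintegral_chainLaw_zero (w : W) (f : W → ℝ≥0∞) (hf : Measurable f) :
    ∫⁻ ω, f (ω 0) ∂(chainLaw κ w) = f w := by
  set κ' : (n : ℕ) → Kernel (Finset.Iic n → W) W := fun n =>
    κ.comap (fun h : (Finset.Iic n) → W => h ⟨n, Finset.mem_Iic.2 le_rfl⟩)
      (measurable_pi_apply _) with hκ'
  have e4 : (chainLaw κ w).map (Preorder.frestrictLe (π := fun _ => W) 0) =
      Kernel.partialTraj (X := fun _ => W) κ' 0 0 (fun _ => w) :=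
    Kernel.traj_map_frestrictLe_apply (X := fun _ => W) (κ := κ') 0 0 (fun _ => w)
  have hm' : Measurable fun h : Finset.Iic 0 → W => f (h ⟨0, Finset.mem_Iic.2 le_rfl⟩) :=
    hf.comp (measurable_pi_apply _)
  have : ∫⁻ ω, f (ω 0) ∂(chainLaw κ w) = ∫⁻ h, f (h ⟨0, Finset.mem_Iic.2 le_rfl⟩)
      ∂((chainLaw κ w).map (Preorder.frestrictLe (π := fun _ => W) 0)) := by
    exact (lintegral_map hm' (Preorder.measurable_frestrictLe (X := fun _ => W) 0)).symm
  rw [this, e4, Kernel.partialTraj_self, Kernel.id_apply,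
    lintegral_dirac' _ hm']

lemma measurable_weightedStep {r : W → W → ℝ≥0∞} (hr : Measurable (Function.uncurry r))
    {f : W → ℝ≥0∞} (hf : Measurable f) : Measurable (weightedStep κ r f) :=
  Measurable.lintegral_kernel_prod_right (κ := κ) (f := fun w w' => r w w' * f w')
    (hr.mul (hf.comp measurable_snd))

lemma measurable_iterate_weightedStep {r : W → W → ℝ≥0∞} (hr : Measurable (Function.uncurry r))
    {f : W → ℝ≥0∞} (hf : Measurable f) (n : ℕ) : Measurable ((weightedStep κ r)^[n] f) := by
  induction n with
  | zero => exact hf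
  | succ n ih =>
    rw [Function.iterate_succ_apply']
    exact measurable_weightedStep κ hr ih

lemma measurable_prod_weights {r : W → W → ℝ≥0∞} (hr : Measurable (Function.uncurry r)) (n : ℕ) :
    Measurable fun ω : ℕ → W => ∏ k ∈ Finset.range n, r (ω k) (ω (k + 1)) :=
  Finset.measurable_fun_prod _ fun k _ =>
    hr.comp (by fun_prop : Measurable fun ω : ℕ → W => (ω k, ω (k + 1)))

lemma lintegral_prod_weights_mul {r : W → W → ℝ≥0∞} (hr : Measurable (Function.uncurry r))
    (w : W) (n : ℕ) {f : W → ℝ≥0∞} (hf : Measurable f) :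
    ∫⁻ ω, (∏ k ∈ Finset.range n, r (ω k) (ω (k + 1))) * f (ω n) ∂(chainLaw κ w) =
      (weightedStep κ r)^[n] f w := by
  induction n generalizing f with
  | zero => simpa using lintegral_chainLaw_zero κ w f hf
  | succ n ih =>
    rw [Function.iterate_succ_apply, ← ih (measurable_weightedStep κ hr hf)]
    -- A finite history is extended to a path by freezing it at time n. The first n weights see only
    -- coordinates up to n, so they become a measurable function of the past.
    have hext : Measurable fun (h : Finset.Iic n → W) (k : ℕ) =>
        h ⟨min k n, Finset.mem_Iic.2 (min_le_right k n)⟩ := by fun_prop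
    have hrf : Measurable (Function.uncurry fun w w' => r w w' * f w') :=
      hr.mul (hf.comp measurable_snd)
    have key := lintegral_chainLaw_succ κ w n
      (fun h => (fun ω : ℕ → W => ∏ k ∈ Finset.range n, r (ω k) (ω (k + 1)))
        fun k => h ⟨min k n, Finset.mem_Iic.2 (min_le_right k n)⟩)
      ((measurable_prod_weights hr n).comp hext) (fun w w' => r w w' * f w') hrf
    have hprod : ∀ ω : ℕ → W, ∏ k ∈ Finset.range n,
        r (ω (min k n)) (ω (min (k + 1) n)) = ∏ k ∈ Finset.range n, r (ω k) (ω (k + 1)) := by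
      intro ω
      refine Finset.prod_congr rfl fun k hk => ?_
      have := Finset.mem_range.1 hk
      rw [min_eq_left this.le, min_eq_left (Nat.succ_le_of_lt this)]
    simp only [Preorder.frestrictLe_apply, hprod] at key
    simp only [weightedStep]
    rw [← key]
    refine lintegral_congr fun ω => ?_
    rw [Finset.prod_range_succ, mul_assoc]

lemma measurable_killed {r : W → W → ℝ≥0∞} (hr : Measurable (Function.uncurry r)) {A : Set W}
    (hA : MeasurableSet A) : Measurable (Function.uncurry (killed r A)) :=
  hr.indicator (measurable_fst hA.compl)

lemma measurable_hitWeight {r : W → W → ℝ≥0∞} (hr : Measurable (Function.uncurry r)) {A : Set W}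
    (hA : MeasurableSet A) : Measurable (hitWeight r A) := by
  have : hitWeight r A = fun ω => ∑' n, (∏ k ∈ Finset.range n, killed r A (ω k) (ω (k + 1)))
      * A.indicator (1 : W → ℝ≥0∞) (ω n) := funext (hitWeight_eq_tsum r A)
  rw [this]
  exact Measurable.tsum fun n => (measurable_prod_weights (measurable_killed hr hA) n).mul
    ((measurable_one.indicator hA).comp (measurable_pi_apply n))

theorem lintegral_hitWeight {r : W → W → ℝ≥0∞} (hr : Measurable (Function.uncurry r)) {A : Set W}
    (hA : MeasurableSet A) (w : W) :
    ∫⁻ ω, hitWeight r A ω ∂(chainLaw κ w) = hitValue κ r A w := by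
  have hk := measurable_killed hr hA
  simp only [hitWeight_eq_tsum]
  rw [lintegral_tsum fun n => by exact ((measurable_prod_weights hk n).mul
    ((measurable_one.indicator hA).comp (measurable_pi_apply n))).aemeasurable]
  exact tsum_congr fun n => lintegral_prod_weights_mul κ hk w n (measurable_one.indicator hA)

lemma hitValue_of_mem (r : W → W → ℝ≥0∞) {A : Set W} {w : W} (hw : w ∈ A) :
    hitValue κ r A w = 1 := by
  rw [hitValue, tsum_eq_single 0]
  · simp [hw]
  · intro n hn
    obtain ⟨m, rfl⟩ := Nat.exists_eq_succ_of_ne_zero hn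
    rw [Function.iterate_succ_apply', weightedStep]
    simp [killed, hw]

/-- First-step analysis: off `A` the zeroth term vanishes, and the step operator commutes with the
series of non-negative functions. -/
lemma hitValue_of_notMem {r : W → W → ℝ≥0∞} (hr : Measurable (Function.uncurry r)) {A : Set W}
    (hA : MeasurableSet A) {w : W} (hw : w ∉ A) :
    hitValue κ r A w = weightedStep κ r (hitValue κ r A) w := by
  have hk := measurable_killed hr hA
  have hrw : Measurable (r w) := hr.comp (by fun_prop : Measurable fun w' => (w, w'))
  rw [hitValue, tsum_eq_zero_add' ENNReal.summable]
  simp only [Function.iterate_zero, id, Set.indicator_of_notMem hw, zero_add,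
    Function.iterate_succ_apply']
  simp only [weightedStep, hitValue, ← ENNReal.tsum_mul_left]
  rw [lintegral_tsum fun n => by exact (hrw.mul (measurable_iterate_weightedStep κ hk
    (measurable_one.indicator hA) n)).aemeasurable]
  refine tsum_congr fun n => lintegral_congr fun w' => ?_
  rw [killed, Set.indicator_of_mem (by simpa using hw)]

lemma measurable_hitValue {r : W → W → ℝ≥0∞} (hr : Measurable (Function.uncurry r)) {A : Set W}
    (hA : MeasurableSet A) : Measurable (hitValue κ r A) :=
  Measurable.tsum fun n => measurable_iterate_weightedStep κ (measurable_killed hr hA)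
    (measurable_one.indicator hA) n

/-- A non-negative function that is at least `1` on `A` and superharmonic off `A` dominates the
expected accumulated weight. -/
theorem hitValue_le {r : W → W → ℝ≥0∞} (hr : Measurable (Function.uncurry r)) {A : Set W}
    (hA : MeasurableSet A) {H : W → ℝ≥0∞} (h1 : ∀ w ∈ A, 1 ≤ H w)
    (h2 : ∀ w ∉ A, weightedStep κ r H w ≤ H w) (w : W) : hitValue κ r A w ≤ H w := by
  have hk := measurable_killed hr hA
  -- Induction on partial sums of the series replaces optional stopping, so no integrability or
  -- finiteness of the hitting time is needed.
  have key : ∀ n w, ∑ k ∈ Finset.range n,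
      (weightedStep κ (killed r A))^[k] (A.indicator 1) w ≤ H w := by
    intro n
    induction n with
    | zero => simp
    | succ n ih =>
      intro w
      rw [Finset.sum_range_succ']
      by_cases hw : w ∈ A
      · refine le_trans (le_of_eq ?_) (h1 w hw)
        simp [Function.iterate_succ_apply', weightedStep, killed, hw]
      · simp only [Function.iterate_zero, id, Set.indicator_of_notMem hw, add_zero,
          Function.iterate_succ_apply']
        refine le_trans ?_ (h2 w hw)
        refine le_trans (le_of_eq ?_) (weightedStep_mono κ r ih w)
        have hrw : Measurable (r w) := hr.comp (by fun_prop : Measurable fun w' => (w, w'))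
        simp only [weightedStep, Finset.mul_sum]
        rw [lintegral_finsetSum _ fun n _ => by exact hrw.mul (measurable_iterate_weightedStep κ hk
          (measurable_one.indicator hA) n)]
        refine Finset.sum_congr rfl fun n _ => lintegral_congr fun w' => ?_
        rw [killed, Set.indicator_of_mem (by simpa using hw)]
  exact ENNReal.tsum_le_of_sum_range_le fun n => key n w

end Chain

section Chain

variable {W : Type*}

lemma hitWeight_one_eq_indicator (A : Set W) :
    hitWeight (fun _ _ => 1) A = {ω : ℕ → W | ∃ n, ω n ∈ A}.indicator 1 := by
  classical
  funext ω
  simp [hitWeight, Set.indicator_apply]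

variable [MeasurableSpace W]

/-- The expected accumulated weight depends only on the step operators off the target. -/
lemma hitValue_congr (κ κ' : Kernel W W) [IsMarkovKernel κ] [IsMarkovKernel κ']
    {r r' : W → W → ℝ≥0∞} (hr' : Measurable (Function.uncurry r')) {A : Set W}
    (hA : MeasurableSet A)
    (h : ∀ f : W → ℝ≥0∞, Measurable f → ∀ w, weightedStep κ r f w = weightedStep κ' r' f w)
    (w : W) : hitValue κ r A w = hitValue κ' r' A w := by
  have key : ∀ n, (weightedStep κ (killed r A))^[n] (A.indicator 1) =
      (weightedStep κ' (killed r' A))^[n] (A.indicator 1) := by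
    intro n
    induction n with
    | zero => rfl
    | succ n ih =>
      rw [Function.iterate_succ_apply', Function.iterate_succ_apply', ih]
      have hm := measurable_iterate_weightedStep κ' (measurable_killed hr' hA)
        (measurable_one.indicator hA) n
      funext w
      by_cases hw : w ∈ A
      · simp [weightedStep, killed, hw]
      · have := h _ hm w
        simpa [weightedStep, killed, hw] using this
  simp only [hitValue, key]

lemma hitValue_one_eq (κ : Kernel W W) [IsMarkovKernel κ] {A : Set W} (hA : MeasurableSet A)
    (w : W) : hitValue κ (fun _ _ => 1) A w = chainLaw κ w {ω | ∃ n, ω n ∈ A} := by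
  rw [← lintegral_hitWeight κ measurable_const hA, hitWeight_one_eq_indicator,
    lintegral_indicator_one]
  rw [Set.ofPred_exists]
  exact MeasurableSet.iUnion fun n => measurable_pi_apply n hA

end Chain

/-- The set of states in which the algorithm stops. -/
def ruin (S : Type*) : Set (State S) := {w | 1 < w.2.1}

lemma measurableSet_ruin (S : Type*) [MeasurableSpace S] : MeasurableSet (ruin S) :=
  measurableSet_lt measurable_const (by fun_prop)

/-! ### Ruin probability of the nominal chain -/

namespace Model

variable {S : Type*} [Fintype S]

lemma FinitePsi.anti {M : Model S} {θ : ℝ} (h0 : 0 ≤ θ) {θ' : ℝ} (h : θ ≤ θ') (hfin : M.FinitePsi θ') :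
    M.FinitePsi θ := by
  intro x
  have hγ : Measurable fun e : ℝ × ℝ => M.γ x e.1 := (M.measurable_γ x).comp measurable_fst
  refine ((integrable_const (1 : ℝ)).add (hfin x)).mono'
    (hγ.const_mul θ).exp.aestronglyMeasurable (ae_of_all _ fun e => ?_)
  rw [Real.norm_eq_abs, abs_of_pos (Real.exp_pos _)]
  simp only [Pi.add_apply]
  rcases le_total (M.γ x e.1) 0 with h1 | h1
  · have : Real.exp (θ * M.γ x e.1) ≤ 1 :=
      Real.exp_le_one_iff.2 (mul_nonpos_of_nonneg_of_nonpos h0 h1)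
    linarith [Real.exp_pos (θ' * M.γ x e.1)]
  · have : Real.exp (θ * M.γ x e.1) ≤ Real.exp (θ' * M.γ x e.1) :=
      Real.exp_le_exp.2 (mul_le_mul_of_nonneg_right h h1)
    linarith

lemma exp_χ {M : Model S} {θ : ℝ} (hfin : M.FinitePsi θ) (y : S) :
    Real.exp (M.χ y θ) = ∫ e, Real.exp (θ * M.γ y e.1) ∂M.ν := by
  have := mgf_pos (hfin y) (X := fun e : ℝ × ℝ => M.γ y e.1) (μ := M.ν)
  rw [Model.χ, cgf, Real.exp_log this]
  rfl

lemma lintegral_exp {M : Model S} {θ : ℝ} (hfin : M.FinitePsi θ) (y : S) :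
    ∫⁻ e, ENNReal.ofReal (Real.exp (θ * M.γ y e.1)) ∂M.ν =
      ENNReal.ofReal (Real.exp (M.χ y θ)) := by
  rw [exp_χ hfin, ofReal_integral_eq_lintegral_ofReal (hfin y)
    (ae_of_all _ fun e => (Real.exp_pos _).le)]

variable (M : Model S) [MeasurableSpace S]

lemma lintegral_nominalStep (x : S) {f : S × (ℝ × ℝ) → ℝ≥0∞} (hf : Measurable f) :
    ∫⁻ p, f p ∂(M.nominalStep x) = ∑ y, ENNReal.ofReal (M.K x y) * ∫⁻ e, f (y, e) ∂M.ν := by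
  rw [nominalStep, lintegral_finsetSum_measure]
  refine Finset.sum_congr rfl fun y _ => ?_
  rw [lintegral_smul_measure, smul_eq_mul, lintegral_prod _ hf.aemeasurable, lintegral_dirac']
  exact hf.lintegral_prod_right'

variable [MeasurableSingletonClass S]

lemma lintegral_transition (Δ : ℝ) (w : State S) {f : State S → ℝ≥0∞} (hf : Measurable f) :
    ∫⁻ w', f w' ∂(M.transition Δ w) =
      ∑ y, ENNReal.ofReal (M.K w.2.2 y) * ∫⁻ e, f (M.update Δ (w, (y, e))) ∂M.ν := by
  have hu := M.measurable_update Δ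
  rw [transition, Kernel.map_apply _ hu, lintegral_map hf hu, Kernel.prod_apply, Kernel.id_apply,
    lintegral_prod (fun a => f (M.update Δ a)) (hf.comp hu).aemeasurable, lintegral_dirac', Kernel.comap_apply]
  · exact M.lintegral_nominalStep _ (hf.comp (hu.comp measurable_prodMk_left))
  · exact (hf.comp hu).lintegral_prod_right'

/-- The probability `P_w(T_Δ < ∞)` of eventual ruin. -/
def ruinProb (Δ : ℝ) : State S → ℝ≥0∞ := hitValue (M.transition Δ) (fun _ _ => 1) (ruin S)

lemma measurable_ruinProb (Δ : ℝ) : Measurable (M.ruinProb Δ) :=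
  measurable_hitValue _ measurable_const (measurableSet_ruin S)

lemma ruinProb_le_one (Δ : ℝ) (w : State S) : M.ruinProb Δ w ≤ 1 := by
  rw [ruinProb, hitValue_one_eq _ (measurableSet_ruin S)]
  exact prob_le_one

lemma ruinProb_of_mem (Δ : ℝ) {w : State S} (hw : 1 < w.2.1) : M.ruinProb Δ w = 1 :=
  hitValue_of_mem _ _ hw

lemma ruinProb_of_le (Δ : ℝ) {w : State S} (hw : w.2.1 ≤ 1) :
    M.ruinProb Δ w = ∑ y, ENNReal.ofReal (M.K w.2.2 y)
      * ∫⁻ e, M.ruinProb Δ (M.update Δ (w, (y, e))) ∂M.ν := by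
  rw [← M.lintegral_transition Δ w (M.measurable_ruinProb Δ)]
  have := hitValue_of_notMem (M.transition Δ) (r := fun _ _ => 1) measurable_const
    (measurableSet_ruin S) (w := w) (not_lt.2 hw)
  simp only [weightedStep, one_mul] at this
  exact this

/-- A supremum strictly exceeds 1 exactly when some D_n does, so the tail event is a visit to
`ruin`. -/
lemma ofReal_φ (x₀ : S) (Δ : ℝ) : ENNReal.ofReal (M.φ x₀ Δ) = M.ruinProb Δ (0, 0, x₀) := by
  have : {ω : ℕ → State S | 1 < Dinf ω} = {ω | ∃ n, ω n ∈ ruin S} := by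
    ext ω
    simp only [Dinf, Set.mem_ofPred_eq, lt_iSup_iff, ruin]
    exact exists_congr fun n => EReal.coe_lt_coe_iff (x := 1)
  rw [ruinProb, hitValue_one_eq _ (measurableSet_ruin S), φ, this, ofReal_measureReal]

end Model

/-! ### Likelihood ratios and the first two moments of the estimator -/

namespace Cramer

variable {S : Type*} [Fintype S] [DecidableEq S] {M : Model S} (T : Cramer M)

lemma root_mem : T.θs ∈ Set.Ioc 0 T.θs := ⟨T.pos, le_rfl⟩

lemma eigen_apply {θ : ℝ} (hθ : θ ∈ Set.Ioc 0 T.θs) (x : S) :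
    ∑ y, M.K x y * Real.exp (M.χ y θ) * T.u θ y = Real.exp (M.ψ θ) * T.u θ x := by
  have := congrFun (T.eigen θ hθ) x
  simpa [Matrix.mulVec, dotProduct, Model.Q] using this

lemma eigen_root (x : S) :
    ∑ y, M.K x y * Real.exp (M.χ y T.θs) * T.u T.θs y = T.u T.θs x := by
  rw [T.eigen_apply T.root_mem, T.psi_root, Real.exp_zero, one_mul]

lemma r_pos (B₁ B₂ Δ : ℝ) (w w' : State S) : 0 < T.r B₁ B₂ Δ w w' := by
  unfold r
  have := T.u_pos _ T.root_mem
  split_ifs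
  · exact mul_pos (Real.exp_pos _) (div_pos (this _) (this _))
  · exact one_pos

/-- The exponent is nonzero so that paths that never stop still contribute 0, rather than 0 ^ 0 = 1.
-/
lemma ofReal_L (B₁ B₂ Δ : ℝ) (p : ℕ) (hp : p ≠ 0) (ω : ℕ → State S) :
    ENNReal.ofReal (T.L B₁ B₂ Δ ω ^ p) =
      hitWeight (fun w w' => ENNReal.ofReal (T.r B₁ B₂ Δ w w' ^ p)) (ruin S) ω := by
  classical
  unfold L hitWeight
  by_cases h : ∃ n, 1 < (ω n).2.1
  · have h' : ∃ n, ω n ∈ ruin S := h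
    rw [if_pos h, if_pos h', ← Finset.prod_pow,
      ENNReal.ofReal_prod_of_nonneg fun k _ => pow_nonneg (T.r_pos _ _ _ _ _).le _]
    rfl
  · have h' : ¬ ∃ n, ω n ∈ ruin S := h
    rw [if_neg h, if_neg h', zero_pow hp, ENNReal.ofReal_zero]

lemma L_nonneg (B₁ B₂ Δ : ℝ) (ω : ℕ → State S) : 0 ≤ T.L B₁ B₂ Δ ω := by
  unfold L
  split_ifs
  · exact Finset.prod_nonneg fun k _ => (T.r_pos _ _ _ _ _).le
  · exact le_rfl

variable [MeasurableSpace S]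

lemma lintegral_tiltedStep (x : S) {f : S × (ℝ × ℝ) → ℝ≥0∞} (hf : Measurable f) :
    ∫⁻ p, f p ∂(T.tiltedStep x) = ∑ y, ENNReal.ofReal (T.tiltedK x y)
      * ∫⁻ e, f (y, e) ∂(M.ν.tilted fun e => T.θs * M.γ y e.1) := by
  rw [tiltedStep, lintegral_finsetSum_measure]
  refine Finset.sum_congr rfl fun y _ => ?_
  have := T.tilted_prob y
  rw [lintegral_smul_measure, smul_eq_mul, lintegral_prod _ hf.aemeasurable, lintegral_dirac']
  exact hf.lintegral_prod_right'

variable [MeasurableSingletonClass S]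

lemma measurable_r (B₁ B₂ Δ : ℝ) : Measurable (Function.uncurry (T.r B₁ B₂ Δ)) := by
  classical
  have hu (θ : ℝ) : Measurable (T.u θ) := measurable_of_finite (T.u θ)
  have h1 := hu T.θs
  refine Measurable.ite (measurable_fst (T.measurableSet_C B₁ B₂ Δ)) ?_ measurable_const
  fun_prop

lemma lintegral_sampler_of_mem (B₁ B₂ Δ : ℝ) {w : State S} (hw : w ∈ T.C B₁ B₂ Δ)
    {f : State S → ℝ≥0∞} (hf : Measurable f) :
    ∫⁻ w', f w' ∂(T.sampler B₁ B₂ Δ w) = ∑ y, ENNReal.ofReal (T.tiltedK w.2.2 y)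
      * ∫⁻ e, f (M.update Δ (w, (y, e))) ∂(M.ν.tilted fun e => T.θs * M.γ y e.1) := by
  classical
  have hu := M.measurable_update Δ
  rw [sampler, Kernel.map_apply _ hu, lintegral_map hf hu, Kernel.prod_apply, Kernel.id_apply,
    lintegral_prod (fun a => f (M.update Δ a)) (hf.comp hu).aemeasurable, lintegral_dirac', Kernel.piecewise_apply,
    if_pos hw, Kernel.comap_apply]
  · exact T.lintegral_tiltedStep _ (hf.comp (hu.comp measurable_prodMk_left))
  · exact (hf.comp hu).lintegral_prod_right'

lemma sampler_apply_of_notMem (B₁ B₂ Δ : ℝ) {w : State S} (hw : w ∉ T.C B₁ B₂ Δ) :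
    T.sampler B₁ B₂ Δ w = M.transition Δ w := by
  classical
  have hu := M.measurable_update Δ
  rw [sampler, Model.transition, Kernel.map_apply _ hu, Kernel.map_apply _ hu, Kernel.prod_apply,
    Kernel.prod_apply, Kernel.piecewise_apply, if_neg hw]

/-- The one-step likelihood ratio undoes the change of measure. -/
theorem lintegral_r_mul_sampler (B₁ B₂ Δ : ℝ) (w : State S) {f : State S → ℝ≥0∞}
    (hf : Measurable f) :
    ∫⁻ w', ENNReal.ofReal (T.r B₁ B₂ Δ w w') * f w' ∂(T.sampler B₁ B₂ Δ w) =
      ∫⁻ w', f w' ∂(M.transition Δ w) := by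
  classical
  by_cases hw : w ∈ T.C B₁ B₂ Δ
  · have hr : Measurable (T.r B₁ B₂ Δ w) :=
      (T.measurable_r B₁ B₂ Δ).comp (by fun_prop : Measurable fun w' => (w, w'))
    rw [T.lintegral_sampler_of_mem B₁ B₂ Δ hw
      (f := fun w' => ENNReal.ofReal (T.r B₁ B₂ Δ w w') * f w') (hr.ennreal_ofReal.mul hf),
      M.lintegral_transition Δ w hf]
    refine Finset.sum_congr rfl fun y _ => ?_
    have hu := T.u_pos _ T.root_mem
    have hx := hu w.2.2
    have hy := hu y
    have hI := Model.exp_χ T.finite_root y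
    rw [lintegral_tilted]
    -- The density of the tilt cancels the exponential in `r` for every e. The constant that remains
    -- is later absorbed by `tiltedK`, as ψ(θ_*) = 0.
    have : ∀ e : ℝ × ℝ, ENNReal.ofReal (Real.exp (T.θs * M.γ y e.1)
        / ∫ e, Real.exp (T.θs * M.γ y e.1) ∂M.ν)
        * (ENNReal.ofReal (T.r B₁ B₂ Δ w (M.update Δ (w, (y, e))))
          * f (M.update Δ (w, (y, e)))) =
        ENNReal.ofReal (T.u T.θs w.2.2 / T.u T.θs y / Real.exp (M.χ y T.θs))
          * f (M.update Δ (w, (y, e))) := by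
      intro e
      rw [← mul_assoc, ← ENNReal.ofReal_mul (by positivity), ← hI]
      congr 2
      simp only [r, if_pos hw, Model.update, add_sub_cancel_left]
      rw [neg_mul, Real.exp_neg]
      field_simp
    rw [lintegral_congr this, lintegral_const_mul' _ _ ENNReal.ofReal_ne_top, ← mul_assoc,
      ← ENNReal.ofReal_mul (T.tiltedK_nonneg _ _), tiltedK, T.psi_root, sub_zero]
    congr 2
    field_simp
  · rw [T.sampler_apply_of_notMem B₁ B₂ Δ hw]
    simp [r, hw]

lemma measurable_L (B₁ B₂ Δ : ℝ) : Measurable (T.L B₁ B₂ Δ) := by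
  have h : T.L B₁ B₂ Δ = fun ω => (hitWeight
      (fun w w' => ENNReal.ofReal (T.r B₁ B₂ Δ w w' ^ 1)) (ruin S) ω).toReal := by
    funext ω
    rw [← T.ofReal_L B₁ B₂ Δ 1 one_ne_zero, pow_one, ENNReal.toReal_ofReal (T.L_nonneg ..)]
  rw [h]
  refine (measurable_hitWeight ?_ (measurableSet_ruin S)).ennreal_toReal
  exact ((T.measurable_r B₁ B₂ Δ).pow_const 1).ennreal_ofReal

/-- First moment of the estimator. -/
theorem lintegral_L (B₁ B₂ Δ : ℝ) (x₀ : S) :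
    ∫⁻ ω, ENNReal.ofReal (T.L B₁ B₂ Δ ω) ∂(T.samplerLaw B₁ B₂ x₀ Δ) =
      ENNReal.ofReal (M.φ x₀ Δ) := by
  have hr : Measurable (Function.uncurry fun w w' => ENNReal.ofReal (T.r B₁ B₂ Δ w w' ^ 1)) :=
    ((T.measurable_r B₁ B₂ Δ).pow_const 1).ennreal_ofReal
  have h (ω) := T.ofReal_L B₁ B₂ Δ 1 one_ne_zero ω
  simp only [pow_one] at h hr
  simp only [h]
  rw [samplerLaw, lintegral_hitWeight _ hr (measurableSet_ruin S), M.ofReal_φ]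
  refine hitValue_congr _ _ measurable_const (measurableSet_ruin S) (fun f hf w => ?_) _
  simp only [weightedStep, one_mul]
  exact T.lintegral_r_mul_sampler B₁ B₂ Δ w hf

/-- Second moment of the estimator. -/
theorem lintegral_L_sq (B₁ B₂ Δ : ℝ) (x₀ : S) :
    ∫⁻ ω, ENNReal.ofReal (T.L B₁ B₂ Δ ω ^ 2) ∂(T.samplerLaw B₁ B₂ x₀ Δ) =
      hitValue (M.transition Δ) (fun w w' => ENNReal.ofReal (T.r B₁ B₂ Δ w w')) (ruin S)
        (0, 0, x₀) := by
  have hr : Measurable (Function.uncurry fun w w' => ENNReal.ofReal (T.r B₁ B₂ Δ w w' ^ 2)) :=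
    ((T.measurable_r B₁ B₂ Δ).pow_const 2).ennreal_ofReal
  have hr1 : Measurable (Function.uncurry fun w w' => ENNReal.ofReal (T.r B₁ B₂ Δ w w')) :=
    (T.measurable_r B₁ B₂ Δ).ennreal_ofReal
  simp only [T.ofReal_L B₁ B₂ Δ 2 two_ne_zero]
  rw [samplerLaw, lintegral_hitWeight _ hr (measurableSet_ruin S)]
  refine hitValue_congr _ _ hr1 (measurableSet_ruin S) (fun f hf w => ?_) _
  have hrw : Measurable fun w' => ENNReal.ofReal (T.r B₁ B₂ Δ w w') :=
    hr1.comp (by fun_prop : Measurable fun w' => (w, w'))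
  simp only [weightedStep]
  -- Of the two factors of r², one pays for the return to the nominal kernel and the other stays as
  -- a weight.
  rw [← T.lintegral_r_mul_sampler B₁ B₂ Δ w
    (f := fun w' => ENNReal.ofReal (T.r B₁ B₂ Δ w w') * f w') (hrw.mul hf)]
  refine lintegral_congr fun w' => ?_
  rw [sq, ENNReal.ofReal_mul (T.r_pos ..).le, mul_assoc]

end Cramer

/-! ### Lyapunov bound for the second moment -/

lemma tendsto_rho : Tendsto rho (𝓝[>] 0) (𝓝[>] 0) := by
  have h : Tendsto (fun Δ : ℝ => Real.log (1 / Δ)) (𝓝[>] 0) atTop := by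
    simp only [one_div]
    exact Real.tendsto_log_atTop.comp tendsto_inv_nhdsGT_zero
  have := tendsto_inv_atTop_nhdsGT_zero.comp h
  refine this.congr fun Δ => ?_
  simp [rho]

/-- This is what the choice of ρ buys: lowering the exponent of Δ from 2θ_* to 2θ_* − ρ costs only
the factor e. -/
lemma rpow_rho {Δ : ℝ} (h0 : 0 < Δ) (h1 : Δ < 1) : Δ ^ rho Δ = Real.exp (-1) := by
  have : Real.log Δ < 0 := Real.log_neg h0 h1
  rw [Real.rpow_def_of_pos h0, rho, one_div Δ, Real.log_inv]
  congr 1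
  field_simp
  rw [div_self this.ne]

/-- One-step estimate behind the Lyapunov inequality: either the reward of the step is at most a
fraction `β` of the remaining distance, or the step is paid for by the reward. -/
lemma lyapunov_pointwise {c p θ β Δ s d z l Ux Uy Vx Vy h' : ℝ} (hc : 0 < c) (hp : 0 < p)
    (hβ : 0 < β) (hβ1 : β < 1) (hΔ : 0 < Δ) (hd : d < 1) (hl : 0 ≤ l) (hUx : 0 < Ux)
    (hUy : 0 < Uy) (hVx : 0 < Vx) (hVy : 0 < Vy) (h1 : h' ≤ 1)
    (h2 : d + Δ * l * Real.exp (s + z) < 1 → h' ≤ c ^ p * Real.exp (p * (s + z))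
      * (Δ / (1 - (d + Δ * l * Real.exp (s + z)))) ^ p * (Uy * Vy)) :
    Real.exp (-θ * z) * (Ux / Uy) * h' ≤
      c ^ p * Real.exp (p * s) * (Δ / (1 - d)) ^ p * (Ux * Vx) *
        ((1 - β) ^ (-p) * Real.exp ((p - θ) * z) * (Vy / Vx) +
          1 / (Uy * Vx) * (c ^ (-p) * β ^ (-p)) * (l ^ p * Real.exp ((p - θ) * z))) := by
  have hd' : 0 < 1 - d := sub_pos.2 hd
  have hβ' : 0 < 1 - β := sub_pos.2 hβ1
  have hcp : 0 < c ^ p := Real.rpow_pos_of_pos hc p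
  have hβp : 0 < β ^ p := Real.rpow_pos_of_pos hβ p
  have hβp' : 0 < (1 - β) ^ p := Real.rpow_pos_of_pos hβ' p
  have hDp : 0 < (Δ / (1 - d)) ^ p := Real.rpow_pos_of_pos (div_pos hΔ hd') p
  have hlp : 0 ≤ l ^ p := Real.rpow_nonneg hl p
  have e1 : Real.exp (p * (s + z)) = Real.exp (p * s) * Real.exp (p * z) := by
    rw [← Real.exp_add]; ring_nf
  have e2 : Real.exp ((p - θ) * z) = Real.exp (-θ * z) * Real.exp (p * z) := by
    rw [← Real.exp_add]; ring_nf
  have hE1 := Real.exp_pos (p * s)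
  have hE2 := Real.exp_pos (p * z)
  have hE3 := Real.exp_pos (-θ * z)
  rw [Real.rpow_neg hβ'.le, Real.rpow_neg hc.le, Real.rpow_neg hβ.le, e2]
  -- Small reward: at least (1 − β)(1 − d) of the distance is left, so the power in the bound on h'
  -- grows by at most (1 − β)^{-p}.
  rcases le_or_gt (Δ * l * Real.exp (s + z)) (β * (1 - d)) with h | h
  · have h3 : (1 - β) * (1 - d) ≤ 1 - (d + Δ * l * Real.exp (s + z)) := by linarith
    have h4 : 0 < (1 - β) * (1 - d) := mul_pos hβ' hd'
    have h5 := h2 (by linarith)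
    have h6 : (Δ / (1 - (d + Δ * l * Real.exp (s + z)))) ^ p ≤
        (Δ / (1 - d)) ^ p * ((1 - β) ^ p)⁻¹ := by
      rw [← Real.inv_rpow hβ'.le, ← Real.mul_rpow (div_pos hΔ hd').le (inv_pos.2 hβ').le]
      refine Real.rpow_le_rpow (div_nonneg hΔ.le (by linarith)) ?_ hp.le
      calc Δ / (1 - (d + Δ * l * Real.exp (s + z))) ≤ Δ / ((1 - β) * (1 - d)) :=
            div_le_div_of_nonneg_left hΔ.le h4 h3
        _ = Δ / (1 - d) * (1 - β)⁻¹ := by field_simp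
    calc Real.exp (-θ * z) * (Ux / Uy) * h'
        ≤ Real.exp (-θ * z) * (Ux / Uy) * (c ^ p * (Real.exp (p * s) * Real.exp (p * z))
          * ((Δ / (1 - d)) ^ p * ((1 - β) ^ p)⁻¹) * (Uy * Vy)) := by
          rw [e1] at h5
          refine mul_le_mul_of_nonneg_left (h5.trans ?_) (by positivity)
          gcongr
      _ = c ^ p * Real.exp (p * s) * (Δ / (1 - d)) ^ p * (Ux * Vx) *
          (((1 - β) ^ p)⁻¹ * (Real.exp (-θ * z) * Real.exp (p * z)) * (Vy / Vx) + 0) := by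
          field_simp
          ring
      _ ≤ _ := by gcongr; positivity
  -- Large reward: the ratio Δ l e^{s+z} / (β(1 − d)) exceeds 1, hence so does its p-th power, and
  -- h' ≤ 1 is bounded by it as in Markov's inequality.
  · have h3 : 1 ≤ (Δ / (1 - d)) ^ p * (Real.exp (p * s) * Real.exp (p * z)) * l ^ p * (β ^ p)⁻¹ := by
      rw [← e1, mul_comm p, Real.exp_mul, ← Real.inv_rpow hβ.le,
        ← Real.mul_rpow (div_pos hΔ hd').le (Real.exp_pos _).le,
        ← Real.mul_rpow (mul_pos (div_pos hΔ hd') (Real.exp_pos _)).le hl,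
        ← Real.mul_rpow (mul_nonneg (mul_pos (div_pos hΔ hd') (Real.exp_pos _)).le hl)
          (inv_pos.2 hβ).le]
      refine Real.one_le_rpow ?_ hp.le
      have : Δ / (1 - d) * Real.exp (s + z) * l * β⁻¹ =
          Δ * l * Real.exp (s + z) / (β * (1 - d)) := by field_simp
      rw [this, one_le_div (by positivity)]
      exact h.le
    calc Real.exp (-θ * z) * (Ux / Uy) * h'
        ≤ Real.exp (-θ * z) * (Ux / Uy) * ((Δ / (1 - d)) ^ p
          * (Real.exp (p * s) * Real.exp (p * z)) * l ^ p * (β ^ p)⁻¹) :=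
          mul_le_mul_of_nonneg_left (h1.trans h3) (by positivity)
      _ = c ^ p * Real.exp (p * s) * (Δ / (1 - d)) ^ p * (Ux * Vx) *
          (0 + 1 / (Uy * Vx) * ((c ^ p)⁻¹ * (β ^ p)⁻¹)
            * (l ^ p * (Real.exp (-θ * z) * Real.exp (p * z)))) := by
          field_simp
          ring
      _ ≤ _ := by gcongr; positivity

namespace Model

variable {S : Type*} [Fintype S] (M : Model S) [MeasurableSpace S] [MeasurableSingletonClass S]

lemma measurable_γ_prod : Measurable fun q : S × (ℝ × ℝ) => M.γ q.1 q.2.1 :=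
  (measurable_from_prod_countable_right (f := fun q : S × ℝ => M.γ q.1 q.2)
    M.measurable_γ).comp (by fun_prop : Measurable fun q : S × (ℝ × ℝ) => (q.1, q.2.1))

lemma lintegral_transition' (Δ : ℝ) (w : State S) {f : State S → ℝ≥0∞} (hf : Measurable f) :
    ∫⁻ w', f w' ∂(M.transition Δ w) = ∫⁻ q, f (M.update Δ (w, q)) ∂(M.nominalStep w.2.2) := by
  rw [M.lintegral_transition Δ w hf, M.lintegral_nominalStep]
  exact hf.comp ((M.measurable_update Δ).comp measurable_prodMk_left)

/-- Action of the transition matrix `Q_θ` on a positive vector, as a one-step expectation. -/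
lemma lintegral_nominalStep_exp {θ : ℝ} (hfin : M.FinitePsi θ) (x : S) {v : S → ℝ}
    (hv : ∀ y, 0 ≤ v y) :
    ∫⁻ q, ENNReal.ofReal (Real.exp (θ * M.γ q.1 q.2.1) * v q.1) ∂(M.nominalStep x) =
      ENNReal.ofReal (∑ y, M.K x y * Real.exp (M.χ y θ) * v y) := by
  have hm : Measurable fun q : S × (ℝ × ℝ) => Real.exp (θ * M.γ q.1 q.2.1) * v q.1 := by
    have h1 := M.measurable_γ_prod
    have h2 : Measurable v := measurable_of_finite v
    fun_prop
  rw [M.lintegral_nominalStep _ hm.ennreal_ofReal, ENNReal.ofReal_sum_of_nonneg fun y _ =>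
    mul_nonneg (mul_nonneg (M.irreducible.nonneg x y) (Real.exp_pos _).le) (hv y)]
  refine Finset.sum_congr rfl fun y _ => ?_
  simp only [ENNReal.ofReal_mul (Real.exp_pos _).le]
  rw [lintegral_mul_const' _ _ ENNReal.ofReal_ne_top, lintegral_exp hfin, ← mul_assoc,
    ← ENNReal.ofReal_mul (M.irreducible.nonneg x y), ← ENNReal.ofReal_mul]
  exact mul_nonneg (M.irreducible.nonneg x y) (Real.exp_pos _).le

end Model

namespace Cramer

variable {S : Type*} [Fintype S] [DecidableEq S] {M : Model S} (T : Cramer M)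

lemma finitePsi_of_mem {θ : ℝ} (hθ : θ ∈ Set.Ioc 0 T.θs) : M.FinitePsi θ :=
  T.finite_root.anti hθ.1.le hθ.2

lemma c_pos {B₁ B₂ Δ : ℝ} (hB₁ : 0 < B₁) (hB₂ : 0 < B₂) (hρ : 0 < rho Δ) : 0 < T.c B₁ B₂ Δ :=
  mul_pos (div_pos hB₂ hB₁) (Real.rpow_pos_of_pos hρ _)

/-- The exponent of ρ in c is chosen for this: with β = B₁ρ, the cost of large rewards becomes
linear in ρ, the same order as the drift gain ρμ that must offset it. -/
lemma c_rpow_neg {B₁ B₂ Δ : ℝ} (hB₁ : 0 < B₁) (hB₂ : 0 < B₂) (hρ : 0 < rho Δ)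
    (hp : 0 < 2 * T.θs - rho Δ) :
    T.c B₁ B₂ Δ ^ (-(2 * T.θs - rho Δ)) * (B₁ * rho Δ) ^ (-(2 * T.θs - rho Δ)) =
      rho Δ / B₂ ^ (2 * T.θs - rho Δ) := by
  set p := 2 * T.θs - rho Δ with hpdef
  rw [← Real.mul_rpow (T.c_pos hB₁ hB₂ hρ).le (mul_pos hB₁ hρ).le]
  have : T.c B₁ B₂ Δ * (B₁ * rho Δ) = B₂ * rho Δ ^ (-(1 / p)) := by
    have h1 : rho Δ ^ (-(1 / p)) = rho Δ ^ (-(1 + 1 / p)) * rho Δ := by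
      conv_rhs => rw [← Real.rpow_add_one hρ.ne']
      ring_nf
    rw [c, ← hpdef, h1]
    field_simp
  rw [this, Real.mul_rpow hB₂.le (Real.rpow_nonneg hρ.le _), ← Real.rpow_mul hρ.le,
    Real.rpow_neg hB₂.le]
  have : -(1 / p) * -p = 1 := by field_simp
  rw [this, Real.rpow_one, div_eq_mul_inv, mul_comm]

lemma h_le_one (B₁ B₂ Δ : ℝ) (w : State S) : T.h B₁ B₂ Δ w ≤ 1 := by
  unfold h
  split_ifs
  · exact min_le_right _ _
  · exact le_rfl

/-- The bound is assumed only below θ_*; left-continuity carries it to the endpoint. -/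
lemma u_root_bound {b₀ : ℝ} (h : ∀ θ ∈ Set.Ioo 0 T.θs, ∀ x, 1 / T.u θ x ^ 2 ≤ b₀)
    (hu : ∀ x, ContinuousWithinAt (fun θ => T.u θ x) (Set.Iic T.θs) T.θs) (x : S) :
    1 / T.u T.θs x ^ 2 ≤ b₀ := by
  have h1 : Tendsto (fun θ => 1 / T.u θ x ^ 2) (𝓝[<] T.θs) (𝓝 (1 / T.u T.θs x ^ 2)) := by
    have : Tendsto (fun θ => T.u θ x) (𝓝[<] T.θs) (𝓝 (T.u T.θs x)) :=
      (hu x).mono_left (nhdsWithin_mono _ Set.Iio_subset_Iic_self)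
    exact tendsto_const_nhds.div (this.pow 2) (pow_ne_zero 2 (T.u_pos _ T.root_mem x).ne')
  refine le_of_tendsto h1 ?_
  filter_upwards [Ioo_mem_nhdsLT T.pos] with θ hθ using h θ hθ x

variable [MeasurableSpace S] [MeasurableSingletonClass S]

lemma measurable_h (B₁ B₂ Δ : ℝ) : Measurable (T.h B₁ B₂ Δ) := by
  have hu (θ : ℝ) : Measurable (T.u θ) := measurable_of_finite (T.u θ)
  have h1 := hu T.θs
  have h2 := hu (T.θs - rho Δ)
  unfold h
  refine Measurable.ite (measurableSet_lt (by fun_prop) (by fun_prop)) ?_ measurable_const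
  fun_prop

/-- Lyapunov inequality in the importance sampling region. -/
lemma lyapunov_of_mem {b₀ b₁ b₂ B₁ B₂ : ℝ} (hB : T.Admissible b₀ b₁ b₂ B₁ B₂)
    (hu : ∀ x, ContinuousWithinAt (fun θ => T.u θ x) (Set.Iic T.θs) T.θs) {Δ : ℝ} (hΔ : 0 < Δ)
    (hρ : 0 < rho Δ) (hρθ : rho Δ < T.θs) (hβ : B₁ * rho Δ < 1)
    (hmain : b₀ * b₂ * rho Δ / B₂ ^ (2 * T.θs - rho Δ)
      + (1 - rho Δ * deriv M.ψ T.θs + b₁ * rho Δ ^ 2)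
        / (1 - B₁ * rho Δ) ^ (2 * T.θs - rho Δ) ≤ 1)
    {w : State S} (hw : w ∈ T.C B₁ B₂ Δ) :
    weightedStep (M.transition Δ) (fun w w' => ENNReal.ofReal (T.r B₁ B₂ Δ w w'))
      (fun w => ENNReal.ofReal (T.h B₁ B₂ Δ w)) w ≤ ENNReal.ofReal (T.h B₁ B₂ Δ w) := by
  obtain ⟨s, d, x⟩ := w
  set ρ := rho Δ with hρdef
  set p := 2 * T.θs - ρ with hpdef
  have hp : 0 < p := by linarith
  have hmem : T.θs - ρ ∈ Set.Ioc 0 T.θs := ⟨by linarith, by linarith⟩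
  have hmem' : T.θs - ρ ∈ Set.Ioo 0 T.θs := ⟨by linarith, by linarith⟩
  have hU := T.u_pos _ T.root_mem
  have hV := T.u_pos _ hmem
  set U := T.u T.θs
  set V := T.u (T.θs - ρ) with hVdef
  have hc := T.c_pos hB.B₁_pos hB.B₂_pos hρ
  set c := T.c B₁ B₂ Δ
  have hβ0 : 0 < B₁ * ρ := mul_pos hB.B₁_pos hρ
  have hd : d < 1 := by
    by_contra hd
    have : T.h B₁ B₂ Δ (s, d, x) < 1 := hw
    simp [h, hd] at this
  have hhw : T.h B₁ B₂ Δ (s, d, x) =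
      c ^ p * Real.exp (p * s) * (Δ / (1 - d)) ^ p * (U x * V x) := by
    have h1 : T.h B₁ B₂ Δ (s, d, x) < 1 := hw
    simp only [h, hd, if_true] at h1 ⊢
    rcases min_lt_iff.1 h1 with h2 | h2
    · exact min_eq_left h2.le
    · exact absurd h2 (lt_irrefl _)
  set H := c ^ p * Real.exp (p * s) * (Δ / (1 - d)) ^ p * (U x * V x) with hH
  have hH0 : 0 < H := by
    have := hU x
    have := hV x
    have := sub_pos.2 hd
    positivity
  have hr : Measurable fun w' => ENNReal.ofReal (T.r B₁ B₂ Δ (s, d, x) w') :=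
    ((T.measurable_r B₁ B₂ Δ).comp (by fun_prop : Measurable
      fun w' : State S => (((s, d, x) : State S), w'))).ennreal_ofReal
  -- Arithmetic–geometric mean: 1/(UV) is at most the average of 1/U² and 1/V².
  have hbU : ∀ y, 1 / (U y * V x) ≤ b₀ := fun y => by
    have h1 := T.u_root_bound hB.b₀_bound hu y
    have h2 := hB.b₀_bound _ hmem' x
    have e1 : 1 / (U y * V x) = (1 / U y) * (1 / V x) := by field_simp
    rw [← one_div_pow] at h1 h2
    rw [e1]
    nlinarith [sq_nonneg (1 / U y - 1 / V x)]
  -- The factor U in `h` cancels the eigenvector ratio in `r`. Since p − θ_* = θ_* − ρ, what is left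
  -- is an exponential tilt at θ_* − ρ, for which V is the eigenvector.
  have hpt : ∀ q : S × (ℝ × ℝ),
      T.r B₁ B₂ Δ (s, d, x) (M.update Δ ((s, d, x), q)) *
        T.h B₁ B₂ Δ (M.update Δ ((s, d, x), q)) ≤
      H * ((1 - B₁ * ρ) ^ (-p) / V x) * (Real.exp ((T.θs - ρ) * M.γ q.1 q.2.1) * V q.1) +
      H * (b₀ * (ρ / B₂ ^ p)) * (M.lam q.1 q.2.2 ^ p * Real.exp ((T.θs - ρ) * M.γ q.1 q.2.1)) := by
    rintro ⟨y, e⟩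
    have := lyapunov_pointwise (θ := T.θs) (s := s) (z := M.γ y e.1)
      (h' := T.h B₁ B₂ Δ (M.update Δ ((s, d, x), (y, e)))) hc hp hβ0 hβ hΔ hd
      (M.lam_nonneg y e.2) (hU x) (hU y) (hV x) (hV y) (T.h_le_one ..) (fun hlt => by
        simp only [Model.update, h, hlt, if_true]
        exact min_le_left _ _)
    rw [T.c_rpow_neg hB.B₁_pos hB.B₂_pos hρ hp, show p - T.θs = T.θs - ρ by rw [hpdef]; ring] at this
    have hr : T.r B₁ B₂ Δ (s, d, x) (M.update Δ ((s, d, x), (y, e))) =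
        Real.exp (-T.θs * M.γ y e.1) * (U x / U y) := by
      simp [r, hw, Model.update, U]
    rw [hr]
    refine this.trans ?_
    have hl : 0 ≤ M.lam y e.2 ^ p := Real.rpow_nonneg (M.lam_nonneg _ _) _
    have hB2p : 0 < B₂ ^ p := Real.rpow_pos_of_pos hB.B₂_pos p
    have hE := Real.exp_pos ((T.θs - ρ) * M.γ y e.1)
    have h3 : H * (1 / (U y * V x) * (ρ / B₂ ^ p) *
        (M.lam y e.2 ^ p * Real.exp ((T.θs - ρ) * M.γ y e.1))) ≤
        H * (b₀ * (ρ / B₂ ^ p) * (M.lam y e.2 ^ p * Real.exp ((T.θs - ρ) * M.γ y e.1))) := by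
      gcongr
      exact hbU y
    have h4 : H * ((1 - B₁ * ρ) ^ (-p) * Real.exp ((T.θs - ρ) * M.γ y e.1) * (V y / V x)) =
        H * ((1 - B₁ * ρ) ^ (-p) / V x) * (Real.exp ((T.θs - ρ) * M.γ y e.1) * V y) := by ring
    rw [mul_add, h4]
    linarith
  have hm : Measurable fun q : S × (ℝ × ℝ) =>
      Real.exp ((T.θs - ρ) * M.γ q.1 q.2.1) * V q.1 := by
    have h1 := M.measurable_γ_prod
    have h2 : Measurable V := measurable_of_finite V
    fun_prop
  have ha1 : 0 ≤ H * ((1 - B₁ * ρ) ^ (-p) / V x) :=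
    mul_nonneg hH0.le (div_nonneg (Real.rpow_nonneg (by linarith) _) (hV x).le)
  have ha2 : 0 ≤ H * (b₀ * (ρ / B₂ ^ p)) :=
    mul_nonneg hH0.le (mul_nonneg hB.b₀_pos.le (div_nonneg hρ.le
      (Real.rpow_nonneg hB.B₂_pos.le _)))
  rw [weightedStep, M.lintegral_transition' Δ _
    (f := fun w' => ENNReal.ofReal (T.r B₁ B₂ Δ (s, d, x) w') * ENNReal.ofReal (T.h B₁ B₂ Δ w'))
    (hr.mul (T.measurable_h B₁ B₂ Δ).ennreal_ofReal), hhw]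
  calc ∫⁻ q, ENNReal.ofReal (T.r B₁ B₂ Δ (s, d, x) (M.update Δ ((s, d, x), q))) *
        ENNReal.ofReal (T.h B₁ B₂ Δ (M.update Δ ((s, d, x), q))) ∂(M.nominalStep x)
      ≤ ∫⁻ q, (ENNReal.ofReal (H * ((1 - B₁ * ρ) ^ (-p) / V x)) *
          ENNReal.ofReal (Real.exp ((T.θs - ρ) * M.γ q.1 q.2.1) * V q.1) +
        ENNReal.ofReal (H * (b₀ * (ρ / B₂ ^ p))) * ENNReal.ofReal
          (M.lam q.1 q.2.2 ^ p * Real.exp ((T.θs - ρ) * M.γ q.1 q.2.1))) ∂(M.nominalStep x) := by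
        refine lintegral_mono fun q => ?_
        rw [← ENNReal.ofReal_mul (T.r_pos ..).le, ← ENNReal.ofReal_mul ha1,
          ← ENNReal.ofReal_mul ha2, ← ENNReal.ofReal_add]
        · exact ENNReal.ofReal_le_ofReal (hpt q)
        · exact mul_nonneg ha1 (mul_nonneg (Real.exp_pos _).le (hV _).le)
        · exact mul_nonneg ha2 (mul_nonneg (Real.rpow_nonneg (M.lam_nonneg _ _) _)
            (Real.exp_pos _).le)
    _ ≤ ENNReal.ofReal (H * ((1 - B₁ * ρ) ^ (-p) / V x)) *
          ENNReal.ofReal (Real.exp (M.ψ (T.θs - ρ)) * V x) +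
        ENNReal.ofReal (H * (b₀ * (ρ / B₂ ^ p))) * ENNReal.ofReal b₂ := by
        rw [lintegral_add_left (hm.ennreal_ofReal.const_mul _),
          lintegral_const_mul' _ _ ENNReal.ofReal_ne_top,
          lintegral_const_mul' _ _ ENNReal.ofReal_ne_top,
          M.lintegral_nominalStep_exp (T.finitePsi_of_mem hmem) x fun y => (hV y).le,
          T.eigen_apply hmem]
        exact add_le_add_right (mul_le_mul_right (hB.b₂_bound x ρ ⟨hρ, hρθ⟩) _) _
    _ ≤ ENNReal.ofReal H := by
        rw [← ENNReal.ofReal_mul ha1, ← ENNReal.ofReal_mul ha2, ← ENNReal.ofReal_add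
          (mul_nonneg ha1 (mul_nonneg (Real.exp_pos _).le (hV x).le))
          (mul_nonneg ha2 hB.b₂_pos.le)]
        refine ENNReal.ofReal_le_ofReal ?_
        have hb1 := hB.b₁_bound ρ ⟨hρ, hρθ⟩
        have hq : 0 < (1 - B₁ * ρ) ^ p := Real.rpow_pos_of_pos (by linarith) p
        have hx := hV x
        calc _ = H * (b₀ * b₂ * ρ / B₂ ^ p + Real.exp (M.ψ (T.θs - ρ)) / (1 - B₁ * ρ) ^ p) := by
              rw [Real.rpow_neg (by linarith)]
              field_simp
              ring
          _ ≤ H * 1 := by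
              refine mul_le_mul_of_nonneg_left (le_trans ?_ hmain) hH0.le
              gcongr
          _ = H := mul_one H

/-- `hitValue_le` applied to `h`, evaluated at the start. Off `C` superharmonicity is free, because
there h = 1 is maximal and the weight is 1. -/
theorem lintegral_L_sq_le {b₀ b₁ b₂ B₁ B₂ : ℝ} (hB : T.Admissible b₀ b₁ b₂ B₁ B₂)
    (hu : ∀ x, ContinuousWithinAt (fun θ => T.u θ x) (Set.Iic T.θs) T.θs) (x₀ : S) :
    ∀ᶠ Δ in 𝓝[>] (0 : ℝ),
      ∫⁻ ω, ENNReal.ofReal (T.L B₁ B₂ Δ ω ^ 2) ∂(T.samplerLaw B₁ B₂ x₀ Δ) ≤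
        ENNReal.ofReal (T.c B₁ B₂ Δ ^ (2 * T.θs - rho Δ) * Δ ^ (2 * T.θs - rho Δ)
          * (T.u T.θs x₀ * T.u (T.θs - rho Δ) x₀)) := by
  have hρ := tendsto_rho.eventually self_mem_nhdsWithin
  have hρ' : Tendsto rho (𝓝[>] 0) (𝓝 0) := tendsto_rho.mono_right nhdsWithin_le_nhds
  filter_upwards [self_mem_nhdsWithin, hρ, hρ'.eventually_lt_const T.pos,
    hρ'.eventually_lt_const (inv_pos.2 hB.B₁_pos), hB.main_bound] with Δ hΔ h1 h2 h3 h4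
  rw [T.lintegral_L_sq]
  have h3' : B₁ * rho Δ < 1 := by
    have := mul_lt_mul_of_pos_left h3 hB.B₁_pos
    rwa [mul_inv_cancel₀ hB.B₁_pos.ne'] at this
  refine (hitValue_le (M.transition Δ) (H := fun w => ENNReal.ofReal (T.h B₁ B₂ Δ w))
    (r := fun w w' => ENNReal.ofReal (T.r B₁ B₂ Δ w w'))
    (T.measurable_r B₁ B₂ Δ).ennreal_ofReal (measurableSet_ruin S) ?_ ?_ _).trans ?_
  · intro w hw
    have : ¬ w.2.1 < 1 := not_lt.2 (le_of_lt hw)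
    simp [h, this]
  · intro w _
    by_cases hw : w ∈ T.C B₁ B₂ Δ
    · exact T.lyapunov_of_mem hB hu hΔ h1 h2 h3' h4 hw
    · have h5 : T.h B₁ B₂ Δ w = 1 := le_antisymm (T.h_le_one ..) (not_lt.1 hw)
      rw [h5, weightedStep]
      calc _ ≤ ∫⁻ _, 1 ∂(M.transition Δ w) := by
            refine lintegral_mono fun w' => ?_
            simpa [r, hw] using T.h_le_one B₁ B₂ Δ w'
        _ = ENNReal.ofReal 1 := by simp
  · refine ENNReal.ofReal_le_ofReal ?_
    simp only [h, zero_lt_one, if_true, mul_zero, Real.exp_zero, mul_one, sub_zero, div_one]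
    exact min_le_left _ _

end Cramer

/-! ### Ruin is likely from high levels -/

namespace Model

variable {S : Type*} [Fintype S] (M : Model S)

lemma K_le_one (x y : S) : M.K x y ≤ 1 := by
  rw [← M.row_sum x]
  exact Finset.single_le_sum (f := fun y => M.K x y) (fun y _ => M.irreducible.nonneg x y)
    (Finset.mem_univ y)

variable [MeasurableSpace S] [MeasurableSingletonClass S]

lemma ruinProb_of_le' (Δ : ℝ) {w : State S} (hw : w.2.1 ≤ 1) :
    M.ruinProb Δ w = ∫⁻ q, M.ruinProb Δ (M.update Δ (w, q)) ∂(M.nominalStep w.2.2) := by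
  rw [M.ruinProb_of_le Δ hw, ← M.lintegral_transition Δ w (M.measurable_ruinProb Δ),
    M.lintegral_transition' Δ w (M.measurable_ruinProb Δ)]

/-- Restrict the first step to the state y and the event `E`. A state already ruined causes no
exception, because the left side never exceeds 1. -/
lemma le_ruinProb_of_step (Δ : ℝ) (w : State S) (y : S) {E : Set (ℝ × ℝ)} (hE : MeasurableSet E)
    {c : ℝ≥0∞} (h : ∀ e ∈ E, c ≤ M.ruinProb Δ (M.update Δ (w, (y, e)))) :
    ENNReal.ofReal (M.K w.2.2 y) * (c * M.ν E) ≤ M.ruinProb Δ w := by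
  have h1 : c * M.ν E ≤ ∫⁻ e, M.ruinProb Δ (M.update Δ (w, (y, e))) ∂M.ν := by
    rw [← setLIntegral_const]
    exact (setLIntegral_mono' hE h).trans (setLIntegral_le_lintegral _ _)
  rcases le_or_gt w.2.1 1 with hw | hw
  · rw [M.ruinProb_of_le Δ hw]
    exact (mul_le_mul_right h1 _).trans (Finset.single_le_sum
      (f := fun y => ENNReal.ofReal (M.K w.2.2 y)
        * ∫⁻ e, M.ruinProb Δ (M.update Δ (w, (y, e))) ∂M.ν)
      (fun _ _ => zero_le) (Finset.mem_univ y))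
  · rw [M.ruinProb_of_mem Δ hw, ← one_mul (1 : ℝ≥0∞)]
    refine mul_le_mul' (ENNReal.ofReal_le_one.2 (M.K_le_one _ _)) (h1.trans ?_)
    calc _ ≤ ∫⁻ _, 1 ∂M.ν := lintegral_mono fun e => M.ruinProb_le_one Δ _
      _ = 1 := by simp

/-- From `x`, once the discounted unit reward `Δ exp(s)` is at least `κ`, ruin has probability
bounded away from zero. -/
def RuinLikely (x : S) : Prop :=
  ∃ κ : ℝ, 0 < κ ∧ ∃ c : ℝ≥0∞, 0 < c ∧ ∀ Δ s d : ℝ, 0 < Δ → 0 ≤ d → κ ≤ Δ * Real.exp s →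
    c ≤ M.ruinProb Δ (s, d, x)

/-- The events {reward > 1/(n+1), γ ≥ −n} exhaust {reward > 0}, so one has positive probability. On
it a single step adds more than 1 as soon as Δ e^s ≥ (n+1) e^n. -/
lemma ruinLikely_of_reward {x y : S} (hxy : 0 < M.K x y) (hy : 0 < M.ν {e | 0 < M.lam y e.2}) :
    M.RuinLikely x := by
  have hγ : Measurable fun e : ℝ × ℝ => M.γ y e.1 := (M.measurable_γ y).comp measurable_fst
  have hl : Measurable fun e : ℝ × ℝ => M.lam y e.2 := (M.measurable_lam y).comp measurable_snd
  have hU : {e : ℝ × ℝ | 0 < M.lam y e.2} ⊆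
      ⋃ n : ℕ, {e | 1 / ((n : ℝ) + 1) < M.lam y e.2 ∧ -(n : ℝ) ≤ M.γ y e.1} := by
    intro e he
    obtain ⟨n, hn⟩ := exists_nat_one_div_lt (show 0 < M.lam y e.2 from he)
    obtain ⟨m, hm⟩ := exists_nat_ge (-M.γ y e.1)
    refine Set.mem_iUnion.2 ⟨max n m, lt_of_le_of_lt ?_ hn, ?_⟩
    · have : (n : ℝ) ≤ (max n m : ℕ) := by exact_mod_cast le_max_left n m
      gcongr
    · have : (m : ℝ) ≤ (max n m : ℕ) := by exact_mod_cast le_max_right n m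
      linarith
  obtain ⟨n, hn⟩ := exists_measure_pos_of_not_measure_iUnion_null
    (hy.trans_le (measure_mono hU)).ne'
  set E := {e : ℝ × ℝ | 1 / ((n : ℝ) + 1) < M.lam y e.2 ∧ -(n : ℝ) ≤ M.γ y e.1}
  have hE : MeasurableSet E :=
    (measurableSet_lt measurable_const hl).inter (measurableSet_le measurable_const hγ)
  have hn1 : (0 : ℝ) < (n : ℝ) + 1 := by positivity
  refine ⟨((n : ℝ) + 1) * Real.exp n, by positivity, ENNReal.ofReal (M.K x y) * (1 * M.ν E),
    ENNReal.mul_pos (ENNReal.ofReal_pos.2 hxy).ne' (by rw [one_mul]; exact hn.ne'), ?_⟩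
  intro Δ s d hΔ hd hκ
  refine M.le_ruinProb_of_step Δ (s, d, x) y hE fun e he => ?_
  rw [M.ruinProb_of_mem]
  simp only [update]
  have h1 : 1 < Δ * M.lam y e.2 * Real.exp (s + M.γ y e.1) := by
    calc (1 : ℝ) = ((n : ℝ) + 1) * Real.exp n * (1 / ((n : ℝ) + 1)) * Real.exp (-n) := by
          rw [Real.exp_neg]; field_simp
      _ < Δ * Real.exp s * M.lam y e.2 * Real.exp (M.γ y e.1) := by
          have h2 := Real.exp_pos (n : ℝ)
          refine mul_lt_mul (mul_lt_mul' hκ he.1 (by positivity) (by positivity))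
            (Real.exp_le_exp.2 he.2) (Real.exp_pos _) ?_
          have := M.lam_nonneg y e.2
          positivity
      _ = _ := by rw [Real.exp_add]; ring
  linarith

/-- With positive probability the step lowers s by at most some n, so raising the threshold by the
factor e^n suffices. -/
lemma RuinLikely.of_step {M : Model S} {x y : S} (hxy : 0 < M.K x y) (hy : M.RuinLikely y) :
    M.RuinLikely x := by
  obtain ⟨κ, hκ, c, hc, h⟩ := hy
  have hγ : Measurable fun e : ℝ × ℝ => M.γ y e.1 := (M.measurable_γ y).comp measurable_fst
  have hU : ⋃ n : ℕ, {e : ℝ × ℝ | -(n : ℝ) ≤ M.γ y e.1} = Set.univ := by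
    refine Set.eq_univ_of_forall fun e => ?_
    obtain ⟨m, hm⟩ := exists_nat_ge (-M.γ y e.1)
    exact Set.mem_iUnion.2 ⟨m, neg_le.1 hm⟩
  obtain ⟨n, hn⟩ := exists_measure_pos_of_not_measure_iUnion_null (μ := M.ν)
    (s := fun n : ℕ => {e : ℝ × ℝ | -(n : ℝ) ≤ M.γ y e.1}) (by rw [hU]; simp)
  refine ⟨κ * Real.exp n, by positivity, ENNReal.ofReal (M.K x y) * (c * M.ν _),
    ENNReal.mul_pos (ENNReal.ofReal_pos.2 hxy).ne' (ENNReal.mul_pos hc.ne' hn.ne').ne', ?_⟩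
  intro Δ s d hΔ hd hκ'
  refine M.le_ruinProb_of_step Δ (s, d, x) y (measurableSet_le measurable_const hγ)
    fun e he => ?_
  refine h Δ _ _ hΔ ?_ ?_
  · have := M.lam_nonneg y e.2
    simp only
    positivity
  · simp only [Real.exp_add]
    calc κ = κ * Real.exp n * Real.exp (-n) := by rw [Real.exp_neg]; field_simp
      _ ≤ Δ * Real.exp s * Real.exp (M.γ y e.1) :=
        mul_le_mul hκ' (Real.exp_le_exp.2 he) (Real.exp_pos _).le (by positivity)
      _ = _ := by ring

/-- Irreducibility gives a path of positive length to a rewarding state. Its last step uses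
`ruinLikely_of_reward`, and the earlier ones are prepended by induction. -/
lemma ruinLikely [DecidableEq S] (h0 : M.RewardsNontrivial) (x : S) : M.RuinLikely x := by
  obtain ⟨x₁, hx₁⟩ := h0
  obtain ⟨k, hk, hpos⟩ :=
    (Matrix.isIrreducible_iff_exists_pow_pos M.irreducible.nonneg).1 M.irreducible x x₁
  obtain ⟨m, rfl⟩ := Nat.exists_eq_succ_of_ne_zero hk.ne'
  clear hk
  induction m generalizing x with
  | zero => exact M.ruinLikely_of_reward (by simpa using hpos) hx₁
  | succ m ih =>
    rw [Nat.succ_eq_add_one, pow_succ', Matrix.mul_apply] at hpos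
    obtain ⟨y, -, hy⟩ := Finset.exists_lt_of_sum_lt (s := Finset.univ) (f := fun _ : S => (0 : ℝ))
      (g := fun y => M.K x y * (M.K ^ (m + 1)) y x₁) (by simpa using hpos)
    have hKpos : 0 < M.K x y := by
      refine lt_of_le_of_ne (M.irreducible.nonneg x y) fun h => ?_
      rw [← h, zero_mul] at hy
      exact lt_irrefl _ hy
    exact (ih y (pos_of_mul_pos_right hy hKpos.le)).of_step hKpos

lemma exists_forall_ruinProb_ge [DecidableEq S] (h0 : M.RewardsNontrivial) :
    ∃ κ : ℝ, 0 < κ ∧ ∃ c : ℝ, 0 < c ∧ c ≤ 1 ∧ ∀ Δ s d x, 0 < Δ → 0 ≤ d → κ ≤ Δ * Real.exp s →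
      ENNReal.ofReal c ≤ M.ruinProb Δ (s, d, x) := by
  choose κ hκ c hc h using M.ruinLikely h0
  -- The cap at 1 keeps the constant finite, so that it can be read as a real number at most 1.
  have hc' : 0 < min (Finset.univ.inf c) 1 :=
    lt_min ((Finset.lt_inf_iff (by simp)).2 fun x _ => hc x) one_pos
  have hc1 : min (Finset.univ.inf c) 1 ≠ ⊤ := ((min_le_right _ _).trans_lt ENNReal.one_lt_top).ne
  refine ⟨1 + ∑ x, κ x, ?_, (min (Finset.univ.inf c) 1).toReal,
    ENNReal.toReal_pos hc'.ne' hc1, ENNReal.toReal_le_of_le_ofReal zero_le_one (by simp), ?_⟩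
  · exact add_pos_of_pos_of_nonneg one_pos (Finset.sum_nonneg fun x _ => (hκ x).le)
  · intro Δ s d x hΔ hd hle
    rw [ENNReal.ofReal_toReal hc1]
    refine ((min_le_left _ _).trans (Finset.inf_le (Finset.mem_univ x))).trans
      (h x Δ s d hΔ hd (le_trans ?_ hle))
    have := Finset.single_le_sum (f := κ) (fun y _ => (hκ y).le) (Finset.mem_univ x)
    linarith

end Model

/-! ### A bounded subharmonic barrier -/

/-- Tangent line bound for the concave function `z ↦ z / (1 + z)`. -/
lemma div_one_add_le_tangent {z m : ℝ} (hz : 0 ≤ z) (hm : 0 ≤ m) :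
    z / (1 + z) ≤ m / (1 + m) + 1 / (1 + m) ^ 2 * (z - m) := by
  have h : m / (1 + m) + 1 / (1 + m) ^ 2 * (z - m) - z / (1 + z) =
      (z - m) ^ 2 / ((1 + m) ^ 2 * (1 + z)) := by
    field_simp
    ring
  have : 0 ≤ (z - m) ^ 2 / ((1 + m) ^ 2 * (1 + z)) := by positivity
  linarith

/-- Quantifies the strict gain from the contraction of z by q. With E = e^{-δt} and t ≤ 0 the gain
decays only like e^{δt}, slowly enough to pay for the cutoff. -/
lemma drop_div_one_add {q E w : ℝ} (hq : 0 ≤ q) (hq1 : q ≤ 1) (hE : 1 ≤ E) (hw : 0 < w) :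
    (1 - q) * (w / (1 + w) ^ 2) * E⁻¹ ≤
      E * w / (1 + E * w) - q * (E * w) / (1 + q * (E * w)) := by
  have hE0 : 0 < E := one_pos.trans_le hE
  have h1 : E * w / (1 + E * w) - q * (E * w) / (1 + q * (E * w)) =
      (1 - q) * (E * w / ((1 + E * w) * (1 + q * (E * w)))) := by
    have : (1 + E * w) ≠ 0 := by positivity
    have : (1 + q * (E * w)) ≠ 0 := by positivity
    field_simp
    ring
  rw [h1, mul_assoc]
  refine mul_le_mul_of_nonneg_left ?_ (sub_nonneg.2 hq1)
  have h2 : (1 + E * w) * (1 + q * (E * w)) ≤ (E * (1 + w)) * (E * (1 + w)) := by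
    have h3 : 1 + E * w ≤ E * (1 + w) := by linarith
    have h4 : 1 + q * (E * w) ≤ E * (1 + w) := by
      have : q * (E * w) ≤ 1 * (E * w) := mul_le_mul_of_nonneg_right hq1 (by positivity)
      linarith
    exact mul_le_mul h3 h4 (by positivity) (by positivity)
  calc w / (1 + w) ^ 2 * E⁻¹ = E * w / ((E * (1 + w)) * (E * (1 + w))) := by field_simp
    _ ≤ _ := by gcongr

/-- `exp(θ t) u` damped by a concave function of `exp(-δ t) v / u` and cut off at level `a`;
here `u` and `v` stand for the values at the current state of eigenvectors of `Q_θ` and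
`Q_{θ - δ}`. -/
def barrier (θ δ a t u v : ℝ) : ℝ :=
  if t ≤ a then Real.exp (θ * t) * u *
    (2 - Real.exp (-δ * t) * (v / u) / (1 + Real.exp (-δ * t) * (v / u))) else 0

section Barrier

variable {θ δ a t u v : ℝ}

lemma barrier_le (hu : 0 < u) (hv : 0 < v) :
    barrier θ δ a t u v ≤ if t ≤ a then 2 * (Real.exp (θ * t) * u) else 0 := by
  unfold barrier
  split_ifs
  · have h := Real.exp_pos (-δ * t)
    have h1 : 0 ≤ Real.exp (-δ * t) * (v / u) / (1 + Real.exp (-δ * t) * (v / u)) := by positivity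
    have h2 : 0 < Real.exp (θ * t) * u := mul_pos (Real.exp_pos _) hu
    nlinarith
  · exact le_rfl

lemma le_barrier (hu : 0 < u) (hv : 0 < v) (ht : t ≤ a) :
    Real.exp (θ * t) * u ≤ barrier θ δ a t u v := by
  rw [barrier, if_pos ht]
  have h := Real.exp_pos (-δ * t)
  have h1 : Real.exp (-δ * t) * (v / u) / (1 + Real.exp (-δ * t) * (v / u)) ≤ 1 :=
    (div_le_one (by positivity)).2 (by linarith)
  have h2 : 0 < Real.exp (θ * t) * u := mul_pos (Real.exp_pos _) hu
  nlinarith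

lemma barrier_nonneg (hu : 0 < u) (hv : 0 < v) : 0 ≤ barrier θ δ a t u v := by
  by_cases ht : t ≤ a
  · exact (mul_pos (Real.exp_pos _) hu).le.trans (le_barrier hu hv ht)
  · rw [barrier, if_neg ht]

/-- Below the cutoff, the tangent at m linearises the damping, so only exponentials that can be
integrated exactly remain. Above it, the barrier is 0 and e^{θt} ≤ e^{-εa} e^{(θ+ε)t} covers the
loss; the coefficient on the left is at most 2. -/
lemma barrier_pointwise {ε m : ℝ} (hu : 0 < u) (hv : 0 < v) (hm : 0 ≤ m) (hε : 0 ≤ ε) :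
    (2 - m / (1 + m) + 1 / (1 + m) ^ 2 * m) * (Real.exp (θ * t) * u) ≤
      barrier θ δ a t u v + 1 / (1 + m) ^ 2 * (Real.exp ((θ - δ) * t) * v) +
        2 * Real.exp (-ε * a) * (Real.exp ((θ + ε) * t) * u) := by
  have hE := Real.exp_pos (θ * t)
  have hA := mul_pos hE hu
  by_cases ht : t ≤ a
  · rw [barrier, if_pos ht]
    have hz : 0 ≤ Real.exp (-δ * t) * (v / u) := by positivity
    have h1 := div_one_add_le_tangent hz hm
    have h2 : Real.exp ((θ - δ) * t) * v =
        Real.exp (θ * t) * u * (Real.exp (-δ * t) * (v / u)) := by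
      rw [show (θ - δ) * t = θ * t + -δ * t by ring, Real.exp_add]
      field_simp
    have h3 : 0 < 2 * Real.exp (-ε * a) * (Real.exp ((θ + ε) * t) * u) := by positivity
    rw [h2]
    nlinarith
  · rw [barrier, if_neg ht]
    have h1 : 1 / (1 + m) ^ 2 * m ≤ m / (1 + m) := by
      rw [div_mul_eq_mul_div, one_mul, div_le_div_iff₀ (by positivity) (by positivity)]
      nlinarith [mul_nonneg hm hm, mul_nonneg (mul_nonneg hm hm) hm]
    have h2 : Real.exp (θ * t) * u ≤ Real.exp (-ε * a) * (Real.exp ((θ + ε) * t) * u) := by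
      rw [← mul_assoc, ← Real.exp_add]
      gcongr
      nlinarith [not_le.1 ht]
    have h3 : 0 < 1 / (1 + m) ^ 2 * (Real.exp ((θ - δ) * t) * v) := by positivity
    nlinarith

end Barrier

lemma exists_pos_le {S : Type*} [Finite S] {f : S → ℝ} (hf : ∀ x, 0 < f x) : ∃ c, 0 < c ∧ ∀ x, c ≤ f x := by
  rcases isEmpty_or_nonempty S with h | h
  · exact ⟨1, one_pos, fun x => h.elim x⟩
  · obtain ⟨x₀, hx₀⟩ := Finite.exists_min f
    exact ⟨f x₀, hf x₀, hx₀⟩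

lemma exists_ge {S : Type*} [Fintype S] (f : S → ℝ) : ∃ c, 0 < c ∧ ∀ x, f x ≤ c := by
  refine ⟨1 + ∑ x, |f x|, add_pos_of_pos_of_nonneg one_pos
    (Finset.sum_nonneg fun x _ => abs_nonneg _), fun x => ?_⟩
  have := Finset.single_le_sum (f := fun x => |f x|) (fun y _ => abs_nonneg _) (Finset.mem_univ x)
  linarith [le_abs_self (f x)]

namespace Cramer

variable {S : Type*} [Fintype S] [DecidableEq S] {M : Model S} (T : Cramer M)

/-- Decrease of the spectral radius just below the root. -/
lemma exists_tilt {b₁ : ℝ} (hμ : 0 < deriv M.ψ T.θs) (hb₁ : 0 < b₁)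
    (hb : ∀ δ ∈ Set.Ioo 0 T.θs,
      Real.exp (M.ψ (T.θs - δ)) ≤ 1 - δ * deriv M.ψ T.θs + b₁ * δ ^ 2) {ε : ℝ} (hε : 0 < ε) :
    ∃ δ ∈ Set.Ioo 0 T.θs, δ ≤ ε ∧ Real.exp (M.ψ (T.θs - δ)) < 1 := by
  -- For δ ≤ μ/(2b₁) the quadratic term takes at most half of the linear gain δμ.
  have h0 : 0 < deriv M.ψ T.θs / (2 * b₁) := by positivity
  have hpos : 0 < min (T.θs / 2) (min ε (deriv M.ψ T.θs / (2 * b₁))) :=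
    lt_min (half_pos T.pos) (lt_min hε h0)
  have h1 := min_le_left (T.θs / 2) (min ε (deriv M.ψ T.θs / (2 * b₁)))
  have h2 := min_le_right (T.θs / 2) (min ε (deriv M.ψ T.θs / (2 * b₁)))
  set δ := min (T.θs / 2) (min ε (deriv M.ψ T.θs / (2 * b₁)))
  have hmem : δ ∈ Set.Ioo 0 T.θs := ⟨hpos, by linarith [T.pos]⟩
  refine ⟨δ, hmem, h2.trans (min_le_left _ _), (hb δ hmem).trans_lt ?_⟩
  have h3 : δ * (2 * b₁) ≤ deriv M.ψ T.θs :=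
    (le_div_iff₀ (by positivity)).1 (h2.trans (min_le_right _ _))
  nlinarith [mul_pos hpos hμ]

variable [MeasurableSpace S] [MeasurableSingletonClass S]

/-- Subharmonicity of the barrier below level `0` (one-step form). -/
lemma barrier_le_lintegral {δ ε a C : ℝ} (hδ : δ ∈ Set.Ioo 0 T.θs) (hδε : δ ≤ ε)
    (hq : Real.exp (M.ψ (T.θs - δ)) < 1) (hfin : M.FinitePsi (T.θs + ε)) (ha : 0 ≤ a) {x : S}
    (hC : ∑ y, M.K x y * Real.exp (M.χ y (T.θs + ε)) * T.u T.θs y ≤ C * T.u T.θs x)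
    (hC0 : 0 ≤ C)
    (hsmall : 2 * Real.exp (-ε * a) * C ≤ (1 - Real.exp (M.ψ (T.θs - δ))) *
      (T.u (T.θs - δ) x / T.u T.θs x / (1 + T.u (T.θs - δ) x / T.u T.θs x) ^ 2))
    {t : ℝ} (ht : t ≤ 0) :
    ENNReal.ofReal (barrier T.θs δ a t (T.u T.θs x) (T.u (T.θs - δ) x)) ≤
      ∫⁻ p, ENNReal.ofReal (barrier T.θs δ a (t + M.γ p.1 p.2.1) (T.u T.θs p.1)
        (T.u (T.θs - δ) p.1)) ∂(M.nominalStep x) := by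
  have hε : 0 < ε := hδ.1.trans_le hδε
  have hmem : T.θs - δ ∈ Set.Ioc 0 T.θs := ⟨by linarith [hδ.2], by linarith [hδ.1]⟩
  have hU := T.u_pos _ T.root_mem
  have hV := T.u_pos _ hmem
  set θ := T.θs with hθ
  set U := T.u θ with hUdef
  set V := T.u (θ - δ) with hVdef
  set q := Real.exp (M.ψ (θ - δ)) with hqdef
  have hq0 : 0 < q := Real.exp_pos _
  have hUx := hU x
  have hVx := hV x
  set Z := Real.exp (-δ * t) * (V x / U x) with hZ
  have hZ0 : 0 < Z := mul_pos (Real.exp_pos _) (div_pos hVx hUx)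
  -- m is the mean of Z after one step tilted by e^{θγ} and U. Taking the tangent there is Jensen's
  -- inequality for the concave damping.
  set m := q * Z with hm
  have hm0 : 0 < m := mul_pos hq0 hZ0
  set β := 1 / (1 + m) ^ 2 with hβ
  have hβ0 : 0 < β := by positivity
  set A := 2 - m / (1 + m) + β * m with hA
  have hA0 : 0 ≤ A := by
    have : m / (1 + m) ≤ 1 := (div_le_one (by positivity)).2 (by linarith)
    have : 0 < β * m := by positivity
    linarith
  set κ := 2 * Real.exp (-ε * a) with hκ
  have hκ0 : 0 < κ := by positivity
  -- measurability of the exponential weights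
  have hmeas : ∀ (η : ℝ) (v : S → ℝ), Measurable fun p : S × (ℝ × ℝ) =>
      Real.exp (η * M.γ p.1 p.2.1) * v p.1 := fun η v => by
    have h1 := M.measurable_γ_prod
    have h2 : Measurable v := measurable_of_finite v
    fun_prop
  have hexp : ∀ (η : ℝ) (p : S × (ℝ × ℝ)) (v : S → ℝ),
      Real.exp (η * (t + M.γ p.1 p.2.1)) * v p.1 =
        Real.exp (η * t) * (Real.exp (η * M.γ p.1 p.2.1) * v p.1) := fun η p v => by
    rw [mul_add, Real.exp_add, mul_assoc]
  have hint : ∀ {η k : ℝ} (_ : 0 ≤ k) (_ : M.FinitePsi η) (v : S → ℝ) (_ : ∀ y, 0 ≤ v y),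
      ∫⁻ p, ENNReal.ofReal (k * (Real.exp (η * (t + M.γ p.1 p.2.1)) * v p.1))
        ∂(M.nominalStep x) =
      ENNReal.ofReal (k * (Real.exp (η * t) *
        ∑ y, M.K x y * Real.exp (M.χ y η) * v y)) := by
    intro η k hk hη v hv
    simp only [hexp, ← mul_assoc k]
    simp only [ENNReal.ofReal_mul (mul_nonneg hk (Real.exp_pos (η * t)).le)]
    rw [lintegral_const_mul' _ _ ENNReal.ofReal_ne_top, M.lintegral_nominalStep_exp hη x hv]
  have hm2 : Measurable fun p : S × (ℝ × ℝ) =>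
      β * (Real.exp ((θ - δ) * (t + M.γ p.1 p.2.1)) * V p.1) := by
    simp only [hexp]
    exact ((hmeas (θ - δ) V).const_mul _).const_mul _
  have hm3 : Measurable fun p : S × (ℝ × ℝ) =>
      κ * (Real.exp ((θ + ε) * (t + M.γ p.1 p.2.1)) * U p.1) := by
    simp only [hexp]
    exact ((hmeas (θ + ε) U).const_mul _).const_mul _
  have hle : ∫⁻ p, ENNReal.ofReal (A * (Real.exp (θ * (t + M.γ p.1 p.2.1)) * U p.1))
        ∂(M.nominalStep x) ≤
      ∫⁻ p, ENNReal.ofReal (barrier θ δ a (t + M.γ p.1 p.2.1) (U p.1) (V p.1))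
        ∂(M.nominalStep x) +
      ∫⁻ p, ENNReal.ofReal (β * (Real.exp ((θ - δ) * (t + M.γ p.1 p.2.1)) * V p.1))
        ∂(M.nominalStep x) +
      ∫⁻ p, ENNReal.ofReal (κ * (Real.exp ((θ + ε) * (t + M.γ p.1 p.2.1)) * U p.1))
        ∂(M.nominalStep x) := by
    rw [← lintegral_add_right _ hm2.ennreal_ofReal, ← lintegral_add_right _ hm3.ennreal_ofReal]
    refine lintegral_mono fun p => ?_
    have hb := barrier_nonneg (θ := θ) (δ := δ) (a := a) (t := t + M.γ p.1 p.2.1) (hU p.1) (hV p.1)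
    have h2 : 0 ≤ β * (Real.exp ((θ - δ) * (t + M.γ p.1 p.2.1)) * V p.1) :=
      mul_nonneg hβ0.le (mul_nonneg (Real.exp_pos _).le (hV _).le)
    have h3 : 0 ≤ κ * (Real.exp ((θ + ε) * (t + M.γ p.1 p.2.1)) * U p.1) :=
      mul_nonneg hκ0.le (mul_nonneg (Real.exp_pos _).le (hU _).le)
    rw [← ENNReal.ofReal_add hb h2, ← ENNReal.ofReal_add (add_nonneg hb h2) h3]
    exact ENNReal.ofReal_le_ofReal (barrier_pointwise (hU p.1) (hV p.1) hm0.le hε.le)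
  rw [hint hA0 T.finite_root U fun y => (hU y).le, hint hβ0.le (T.finitePsi_of_mem hmem) V
    fun y => (hV y).le, hint hκ0.le hfin U fun y => (hU y).le, T.eigen_root, T.eigen_apply hmem,
    add_assoc] at hle
  have hnn : 0 ≤ β * (Real.exp ((θ - δ) * t) * (q * V x)) := by positivity
  have hnn2 : 0 ≤ κ * (Real.exp ((θ + ε) * t) *
      ∑ y, M.K x y * Real.exp (M.χ y (θ + ε)) * U y) :=
    mul_nonneg hκ0.le (mul_nonneg (Real.exp_pos _).le (Finset.sum_nonneg fun y _ =>
      mul_nonneg (mul_nonneg (M.irreducible.nonneg x y) (Real.exp_pos _).le) (hU y).le))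
  rw [← ENNReal.ofReal_add hnn hnn2] at hle
  refine le_trans ?_ (tsub_le_iff_right.2 hle)
  rw [← ENNReal.ofReal_sub _ (add_nonneg hnn hnn2)]
  refine ENNReal.ofReal_le_ofReal ?_
  rw [barrier, if_pos (ht.trans ha)]
  have hE := Real.exp_pos (θ * t)
  have e1 : β * (Real.exp ((θ - δ) * t) * (q * V x)) = Real.exp (θ * t) * U x * (β * m) := by
    rw [show (θ - δ) * t = θ * t + -δ * t by ring, Real.exp_add, hm, hZ]
    field_simp
  have e2 : Real.exp ((θ + ε) * t) = Real.exp (θ * t) * Real.exp (ε * t) := by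
    rw [← Real.exp_add]; ring_nf
  have e3 : κ * (Real.exp ((θ + ε) * t) * ∑ y, M.K x y * Real.exp (M.χ y (θ + ε)) * U y) ≤
      Real.exp (θ * t) * U x * (κ * C * Real.exp (ε * t)) := by
    rw [e2]
    calc _ ≤ κ * (Real.exp (θ * t) * Real.exp (ε * t) * (C * U x)) := by gcongr
      _ = _ := by ring
  -- The cutoff loss decays like e^{εt} and the damping gain like e^{δt}. As δ ≤ ε and t ≤ 0, the
  -- comparison `hsmall` of the constants suffices.
  have e4 : κ * C * Real.exp (ε * t) ≤ Z / (1 + Z) - m / (1 + m) := by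
    have h1 : 1 ≤ Real.exp (-δ * t) := Real.one_le_exp (by nlinarith [hδ.1])
    have h2 := drop_div_one_add hq0.le hq.le h1 (div_pos hVx hUx)
    refine le_trans ?_ h2
    have h3 : (Real.exp (-δ * t))⁻¹ = Real.exp (δ * t) := by rw [← Real.exp_neg]; ring_nf
    rw [h3]
    have h4 : Real.exp (ε * t) ≤ Real.exp (δ * t) := Real.exp_le_exp.2 (by nlinarith)
    exact mul_le_mul hsmall h4 (Real.exp_pos _).le (le_trans (by positivity) hsmall)
  have e5 : Real.exp (θ * t) * U x * (κ * C * Real.exp (ε * t)) ≤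
      Real.exp (θ * t) * U x * (Z / (1 + Z) - m / (1 + m)) :=
    mul_le_mul_of_nonneg_left e4 (by positivity)
  rw [e1, hA]
  linarith

end Cramer

/-! ### Lower bound for the ruin probability -/

namespace Cramer

variable {S : Type*} [Fintype S] [DecidableEq S] {M : Model S} (T : Cramer M)

section LowerBound

variable [MeasurableSpace S] [MeasurableSingletonClass S]

/-- A bounded function that is subharmonic below a level and decays at `-∞` is a lower bound for
the ruin probability. -/
lemma le_ruinProb {δ a b c₁ c₀ C₃ Δ : ℝ} (hΔ : 0 < Δ) (hδ : δ ∈ Set.Ioo 0 T.θs)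
    (hq : Real.exp (M.ψ (T.θs - δ)) < 1)
    (hsub : ∀ x, ∀ t ≤ 0, ENNReal.ofReal (barrier T.θs δ a t (T.u T.θs x) (T.u (T.θs - δ) x)) ≤
      ∫⁻ p, ENNReal.ofReal (barrier T.θs δ a (t + M.γ p.1 p.2.1) (T.u T.θs p.1)
        (T.u (T.θs - δ) p.1)) ∂(M.nominalStep x))
    (hc₁ : 0 ≤ c₁) (hc₀ : c₀ ≤ 1) (hC₃ : 0 ≤ C₃)
    (hbdd : ∀ t x, c₁ * barrier T.θs δ a t (T.u T.θs x) (T.u (T.θs - δ) x) ≤ c₀)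
    (hdecay : ∀ t x, c₁ * barrier T.θs δ a t (T.u T.θs x) (T.u (T.θs - δ) x) ≤
      C₃ * (Real.exp ((T.θs - δ) * t) * T.u (T.θs - δ) x))
    (hlikely : ∀ s d x, 0 ≤ d → b ≤ s → ENNReal.ofReal c₀ ≤ M.ruinProb Δ (s, d, x))
    (s d : ℝ) (x : S) (hd : 0 ≤ d) :
    ENNReal.ofReal (c₁ * barrier T.θs δ a (s - b) (T.u T.θs x) (T.u (T.θs - δ) x)) ≤
      M.ruinProb Δ (s, d, x) := by
  have hmem : T.θs - δ ∈ Set.Ioc 0 T.θs := ⟨by linarith [hδ.2], by linarith [hδ.1]⟩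
  have hV := T.u_pos _ hmem
  set θ := T.θs
  set U := T.u θ
  set V := T.u (θ - δ)
  set q := Real.exp (M.ψ (θ - δ)) with hqdef
  have hq0 : 0 < q := Real.exp_pos _
  -- N steps of subharmonicity, with an error that stands for paths still undecided. Its profile
  -- e^{(θ−δ)t} V shrinks in mean by q at each step, so the error vanishes as N grows. Above level b
  -- and after ruin the bound holds outright.
  have key : ∀ N : ℕ, ∀ s d x, 0 ≤ d →
      ENNReal.ofReal (c₁ * barrier θ δ a (s - b) (U x) (V x)) ≤ M.ruinProb Δ (s, d, x) +
        ENNReal.ofReal (C₃ * q ^ N * (Real.exp ((θ - δ) * (s - b)) * V x)) := by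
    intro N
    induction N with
    | zero =>
      intro s d x _
      rw [pow_zero, mul_one]
      exact (ENNReal.ofReal_le_ofReal (hdecay (s - b) x)).trans le_add_self
    | succ N ih =>
      intro s d x hd
      rcases le_or_gt b s with hs | hs
      · exact (ENNReal.ofReal_le_ofReal (hbdd (s - b) x)).trans
          ((hlikely s d x hd hs).trans le_self_add)
      rcases lt_or_ge 1 d with hd1 | hd1
      · rw [M.ruinProb_of_mem Δ (w := (s, d, x)) hd1]
        refine le_trans ?_ le_self_add
        exact ENNReal.ofReal_le_one.2 ((hbdd (s - b) x).trans hc₀)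
      · rw [M.ruinProb_of_le' Δ (w := (s, d, x)) hd1, ENNReal.ofReal_mul hc₁]
        have hg : Measurable fun p => M.ruinProb Δ (M.update Δ ((s, d, x), p)) :=
          (M.measurable_ruinProb Δ).comp ((M.measurable_update Δ).comp measurable_prodMk_left)
        calc _ ≤ ENNReal.ofReal c₁ * ∫⁻ p, ENNReal.ofReal (barrier θ δ a
              (s - b + M.γ p.1 p.2.1) (U p.1) (V p.1)) ∂(M.nominalStep x) :=
              mul_le_mul_right (hsub x (s - b) (by linarith)) _
          _ = ∫⁻ p, ENNReal.ofReal (c₁ * barrier θ δ a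
              (s - b + M.γ p.1 p.2.1) (U p.1) (V p.1)) ∂(M.nominalStep x) := by
              simp only [ENNReal.ofReal_mul hc₁]
              rw [lintegral_const_mul' _ _ ENNReal.ofReal_ne_top]
          _ ≤ ∫⁻ p, (M.ruinProb Δ (M.update Δ ((s, d, x), p)) +
              ENNReal.ofReal (C₃ * q ^ N * Real.exp ((θ - δ) * (s - b))) *
                ENNReal.ofReal (Real.exp ((θ - δ) * M.γ p.1 p.2.1) * V p.1))
              ∂(M.nominalStep x) := by
              refine lintegral_mono fun p => ?_
              have h0 : 0 ≤ d + Δ * M.lam p.1 p.2.2 * Real.exp (s + M.γ p.1 p.2.1) := by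
                have := M.lam_nonneg p.1 p.2.2
                positivity
              have h1 := ih (s + M.γ p.1 p.2.1) _ p.1 h0
              rw [← ENNReal.ofReal_mul (by positivity)]
              rw [show s + M.γ p.1 p.2.1 - b = s - b + M.γ p.1 p.2.1 by ring] at h1
              refine h1.trans (le_of_eq ?_)
              refine congrArg₂ (· + ·) rfl (congrArg ENNReal.ofReal ?_)
              rw [mul_add (θ - δ), Real.exp_add]
              ring
          _ = _ := by
              rw [lintegral_add_left hg, lintegral_const_mul' _ _ ENNReal.ofReal_ne_top,
                M.lintegral_nominalStep_exp (T.finitePsi_of_mem hmem) x fun y => (hV y).le,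
                T.eigen_apply hmem, ← ENNReal.ofReal_mul (by positivity)]
              congr 2
              rw [← hqdef]
              ring
  have hlim : Tendsto (fun N : ℕ => M.ruinProb Δ (s, d, x) +
      ENNReal.ofReal (C₃ * q ^ N * (Real.exp ((θ - δ) * (s - b)) * V x))) atTop
      (𝓝 (M.ruinProb Δ (s, d, x) + ENNReal.ofReal (C₃ * 0 * (Real.exp ((θ - δ) * (s - b)) * V x)))) :=
    tendsto_const_nhds.add (ENNReal.tendsto_ofReal
      (((tendsto_pow_atTop_nhds_zero_of_lt_one hq0.le hq).const_mul C₃).mul_const _))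
  rw [mul_zero, zero_mul, ENNReal.ofReal_zero, add_zero] at hlim
  exact ge_of_tendsto' hlim fun N => key N s d x hd

/-- Lower bound of the order `Δ ^ θ_*` for the tail of the perpetuity. -/
theorem exists_le_φ {b₁ : ℝ} (hlam0 : M.RewardsNontrivial) (hμ : 0 < deriv M.ψ T.θs)
    (hb₁ : 0 < b₁)
    (hb : ∀ δ ∈ Set.Ioo 0 T.θs,
      Real.exp (M.ψ (T.θs - δ)) ≤ 1 - δ * deriv M.ψ T.θs + b₁ * δ ^ 2) (x₀ : S) :
    ∃ k, 0 < k ∧ ∀ᶠ Δ in 𝓝[>] (0 : ℝ), k * Δ ^ T.θs ≤ M.φ x₀ Δ := by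
  obtain ⟨θ₁, hθ₁, hfin⟩ := T.finite_beyond
  obtain ⟨κ, hκ, c₀, hc₀, hc₀1, hlikely⟩ := M.exists_forall_ruinProb_ge hlam0
  have hε : 0 < θ₁ - T.θs := sub_pos.2 hθ₁
  obtain ⟨δ, hδ, hδε, hq⟩ := T.exists_tilt hμ hb₁ hb hε
  have hmem : T.θs - δ ∈ Set.Ioc 0 T.θs := ⟨by linarith [hδ.2], by linarith [hδ.1]⟩
  have hU := T.u_pos _ T.root_mem
  have hV := T.u_pos _ hmem
  set ε := θ₁ - T.θs with hεdef
  have hfin' : M.FinitePsi (T.θs + ε) := by rwa [hεdef, add_sub_cancel]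
  obtain ⟨C, hC0, hC⟩ := exists_ge fun x =>
    (∑ y, M.K x y * Real.exp (M.χ y (T.θs + ε)) * T.u T.θs y) / T.u T.θs x
  obtain ⟨η, hη, hη'⟩ := exists_pos_le (f := fun x => (1 - Real.exp (M.ψ (T.θs - δ))) *
      (T.u (T.θs - δ) x / T.u T.θs x / (1 + T.u (T.θs - δ) x / T.u T.θs x) ^ 2)) fun x => by
    have := hU x
    have := hV x
    have := sub_pos.2 hq
    positivity
  -- The cutoff is placed so high that the overshoot loss stays below η, the uniform gain over the
  -- finitely many states.
  obtain ⟨a, ha, ha'⟩ : ∃ a : ℝ, 0 ≤ a ∧ 2 * Real.exp (-ε * a) * C ≤ η := by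
    have h1 : Tendsto (fun a : ℝ => 2 * Real.exp (-ε * a) * C) atTop (𝓝 (2 * 0 * C)) :=
      ((Real.tendsto_exp_atBot.comp
        (tendsto_id.const_mul_atTop_of_neg (neg_lt_zero.2 hε))).const_mul 2).mul_const C
    rw [mul_zero, zero_mul] at h1
    obtain ⟨a, h2, h3⟩ := ((eventually_ge_atTop 0).and (h1.eventually_lt_const hη)).exists
    exact ⟨a, h2, h3.le⟩
  obtain ⟨C₂, hC₂0, hC₂⟩ := exists_ge fun x => 2 * (Real.exp (T.θs * a) * T.u T.θs x)
  obtain ⟨C₃, hC₃0, hC₃⟩ := exists_ge fun x =>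
    2 * Real.exp (δ * a) * T.u T.θs x / T.u (T.θs - δ) x
  -- This factor scales the barrier, bounded by C₂, down to the ruin probability c₀ guaranteed at
  -- high levels.
  have hc₁ : 0 < c₀ / C₂ := div_pos hc₀ hC₂0
  have hsub : ∀ x, ∀ t ≤ 0,
      ENNReal.ofReal (barrier T.θs δ a t (T.u T.θs x) (T.u (T.θs - δ) x)) ≤
      ∫⁻ p, ENNReal.ofReal (barrier T.θs δ a (t + M.γ p.1 p.2.1) (T.u T.θs p.1)
        (T.u (T.θs - δ) p.1)) ∂(M.nominalStep x) := fun x t ht =>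
    T.barrier_le_lintegral hδ hδε hq hfin' ha ((div_le_iff₀ (hU x)).1 (hC x)) hC0.le
      (ha'.trans (hη' x)) ht
  have hbdd : ∀ t x, c₀ / C₂ * barrier T.θs δ a t (T.u T.θs x) (T.u (T.θs - δ) x) ≤ c₀ := by
    intro t x
    have h1 : barrier T.θs δ a t (T.u T.θs x) (T.u (T.θs - δ) x) ≤ C₂ := by
      refine (barrier_le (hU x) (hV x)).trans ?_
      split_ifs with ht
      · refine le_trans ?_ (hC₂ x)
        have := (hU x).le
        have := T.pos.le
        gcongr
      · exact hC₂0.le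
    calc _ ≤ c₀ / C₂ * C₂ := mul_le_mul_of_nonneg_left h1 hc₁.le
      _ = c₀ := by field_simp
  have hdecay : ∀ t x, c₀ / C₂ * barrier T.θs δ a t (T.u T.θs x) (T.u (T.θs - δ) x) ≤
      c₀ / C₂ * C₃ * (Real.exp ((T.θs - δ) * t) * T.u (T.θs - δ) x) := by
    intro t x
    rw [mul_assoc]
    refine mul_le_mul_of_nonneg_left ((barrier_le (hU x) (hV x)).trans ?_) hc₁.le
    have h0 := hV x
    split_ifs with ht
    · have h1 := (div_le_iff₀ (hV x)).1 (hC₃ x)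
      have h2 : Real.exp (T.θs * t) ≤ Real.exp ((T.θs - δ) * t) * Real.exp (δ * a) := by
        rw [← Real.exp_add]
        have := mul_le_mul_of_nonneg_left ht hδ.1.le
        exact Real.exp_le_exp.2 (by linarith)
      have h3 := hU x
      calc _ ≤ 2 * (Real.exp ((T.θs - δ) * t) * Real.exp (δ * a) * T.u T.θs x) := by gcongr
        _ = Real.exp ((T.θs - δ) * t) * (2 * Real.exp (δ * a) * T.u T.θs x) := by ring
        _ ≤ Real.exp ((T.θs - δ) * t) * (C₃ * T.u (T.θs - δ) x) := by gcongr
        _ = _ := by ring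
    · positivity
  refine ⟨c₀ / C₂ * (T.u T.θs x₀ / κ ^ T.θs), ?_, ?_⟩
  · exact mul_pos hc₁ (div_pos (hU x₀) (Real.rpow_pos_of_pos hκ _))
  filter_upwards [Ioc_mem_nhdsGT hκ] with Δ hΔ
  -- The level b = log(κ/Δ) is where Δ e^s reaches κ. Seen from s = 0 the barrier is evaluated at
  -- −b, where e^{θ_* t} equals (Δ/κ)^{θ_*}.
  have hlog : ∀ s, Real.log (κ / Δ) ≤ s → κ ≤ Δ * Real.exp s := fun s hs => by
    have := (Real.log_le_iff_le_exp (div_pos hκ hΔ.1)).1 hs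
    rwa [div_le_iff₀' hΔ.1] at this
  have hφ0 : 0 ≤ M.φ x₀ Δ := measureReal_nonneg
  rw [← ENNReal.ofReal_le_ofReal_iff hφ0, M.ofReal_φ]
  refine le_trans (ENNReal.ofReal_le_ofReal ?_)
    (T.le_ruinProb (b := Real.log (κ / Δ)) hΔ.1 hδ hq hsub hc₁.le hc₀1
      (mul_nonneg hc₁.le hC₃0.le) hbdd hdecay
      (fun s d x hd hs => hlikely Δ s d x hΔ.1 hd (hlog s hs)) 0 0 x₀ le_rfl)
  rw [mul_assoc]
  refine mul_le_mul_of_nonneg_left ?_ hc₁.le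
  have hlog0 : 0 ≤ Real.log (κ / Δ) := Real.log_nonneg ((one_le_div hΔ.1).2 hΔ.2)
  refine le_trans (le_of_eq ?_) (le_barrier (hU x₀) (hV x₀) (by linarith))
  have : Real.exp (T.θs * (0 - Real.log (κ / Δ))) = Δ ^ T.θs / κ ^ T.θs := by
    rw [← Real.div_rpow hΔ.1.le hκ.le, Real.rpow_def_of_pos (div_pos hΔ.1 hκ),
      Real.log_div hκ.ne' hΔ.1.ne', Real.log_div hΔ.1.ne' hκ.ne']
    ring_nf
  rw [this]
  ring

end LowerBound

/-! ### Growth of c and integrated moments -/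

/-- The exponent of ρ is below −1, so c is eventually at least (B₂/B₁)/ρ. This lets the exponent
2θ_* − ρ of c be raised to 2θ_*. -/
lemma eventually_one_le_c {B₁ B₂ : ℝ} (hB₁ : 0 < B₁) (hB₂ : 0 < B₂) :
    ∀ᶠ Δ in 𝓝[>] (0 : ℝ), 1 ≤ T.c B₁ B₂ Δ := by
  have hρ := tendsto_rho.eventually self_mem_nhdsWithin
  have hρ' : Tendsto rho (𝓝[>] 0) (𝓝 0) := tendsto_rho.mono_right nhdsWithin_le_nhds
  filter_upwards [hρ, hρ'.eventually_lt_const T.pos, hρ'.eventually_lt_const (div_pos hB₂ hB₁),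
    hρ'.eventually_lt_const one_pos] with Δ h1 h2 h3 h4
  have h1 : 0 < rho Δ := h1
  have hp : 0 < 2 * T.θs - rho Δ := by linarith [T.pos]
  have h5 : rho Δ ^ (-1 : ℝ) ≤ rho Δ ^ (-(1 + 1 / (2 * T.θs - rho Δ))) := by
    refine Real.rpow_le_rpow_of_exponent_ge h1 h4.le ?_
    have : 0 < 1 / (2 * T.θs - rho Δ) := by positivity
    linarith
  calc 1 = rho Δ * rho Δ ^ (-1 : ℝ) := by rw [Real.rpow_neg_one, mul_inv_cancel₀ h1.ne']
    _ ≤ B₂ / B₁ * rho Δ ^ (-(1 + 1 / (2 * T.θs - rho Δ))) :=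
      mul_le_mul h3.le h5 (Real.rpow_nonneg h1.le _) (div_pos hB₂ hB₁).le

/-- Once ρ < θ_*, the exponent 1/(2θ_* − ρ) is at most 1/θ_*, so c is bounded by a fixed power of
log(1/Δ), which any power of 1/Δ beats. -/
lemma c_rpow_isBigO {B₁ B₂ : ℝ} (hB₁ : 0 < B₁) (hB₂ : 0 < B₂) {b : ℝ} (hb : 0 < b) :
    (fun Δ => T.c B₁ B₂ Δ ^ (2 * T.θs)) =O[𝓝[>] 0] fun Δ => Δ ^ (-b) := by
  have hlog : Tendsto (fun Δ : ℝ => Real.log (1 / Δ)) (𝓝[>] 0) atTop := by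
    simp only [one_div]
    exact Real.tendsto_log_atTop.comp tendsto_inv_nhdsGT_zero
  have h1 : (fun Δ : ℝ => Real.log (1 / Δ) ^ ((1 + 1 / T.θs) * (2 * T.θs))) =O[𝓝[>] 0]
      fun Δ => Δ ^ (-b) := by
    refine ((isLittleO_rpow_exp_pos_mul_atTop ((1 + 1 / T.θs) * (2 * T.θs)) hb).comp_tendsto
      hlog).isBigO.congr' (by rfl) ?_
    filter_upwards [self_mem_nhdsWithin] with Δ hΔ
    have hΔ : 0 < Δ := hΔ
    rw [Function.comp_apply, Real.rpow_def_of_pos hΔ, one_div, Real.log_inv]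
    ring_nf
  refine IsBigO.trans ?_ h1
  have hρ := tendsto_rho.eventually self_mem_nhdsWithin
  have hρ' : Tendsto rho (𝓝[>] 0) (𝓝 0) := tendsto_rho.mono_right nhdsWithin_le_nhds
  refine IsBigO.of_bound ((B₂ / B₁) ^ (2 * T.θs)) ?_
  filter_upwards [hρ, hρ'.eventually_lt_const T.pos, hρ'.eventually_lt_const one_pos]
    with Δ h1 h2 h4
  have h1 : 0 < rho Δ := h1
  have hc := T.c_pos hB₁ hB₂ h1
  have hl : Real.log (1 / Δ) = (rho Δ)⁻¹ := by simp [rho]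
  have hpow : rho Δ ^ (-(1 + 1 / (2 * T.θs - rho Δ))) ≤ (rho Δ)⁻¹ ^ (1 + 1 / T.θs) := by
    rw [Real.inv_rpow h1.le, ← Real.rpow_neg h1.le]
    refine Real.rpow_le_rpow_of_exponent_ge h1 h4.le ?_
    have : 1 / (2 * T.θs - rho Δ) ≤ 1 / T.θs :=
      one_div_le_one_div_of_le T.pos (by linarith)
    linarith
  have hi : 0 < (rho Δ)⁻¹ := inv_pos.2 h1
  rw [hl, Real.norm_of_nonneg (Real.rpow_nonneg hc.le _),
    Real.norm_of_nonneg (Real.rpow_nonneg hi.le _), Real.rpow_mul hi.le,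
    ← Real.mul_rpow (div_pos hB₂ hB₁).le (Real.rpow_nonneg hi.le _)]
  refine Real.rpow_le_rpow hc.le ?_ (by linarith [T.pos])
  exact mul_le_mul_of_nonneg_left hpow (div_pos hB₂ hB₁).le

variable [MeasurableSpace S] [MeasurableSingletonClass S]

instance samplerLaw_prob (B₁ B₂ : ℝ) (x₀ : S) (Δ : ℝ) :
    IsProbabilityMeasure (T.samplerLaw B₁ B₂ x₀ Δ) := by
  unfold samplerLaw
  infer_instance

theorem integrable_L (B₁ B₂ Δ : ℝ) (x₀ : S) :
    Integrable (T.L B₁ B₂ Δ) (T.samplerLaw B₁ B₂ x₀ Δ) := by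
  refine ⟨(T.measurable_L B₁ B₂ Δ).aestronglyMeasurable, ?_⟩
  rw [hasFiniteIntegral_iff_ofReal (ae_of_all _ (T.L_nonneg B₁ B₂ Δ)), T.lintegral_L]
  exact ENNReal.ofReal_lt_top

theorem integral_L (B₁ B₂ Δ : ℝ) (x₀ : S) :
    ∫ ω, T.L B₁ B₂ Δ ω ∂(T.samplerLaw B₁ B₂ x₀ Δ) = M.φ x₀ Δ := by
  rw [integral_eq_lintegral_of_nonneg_ae (ae_of_all _ (T.L_nonneg B₁ B₂ Δ))
    (T.measurable_L B₁ B₂ Δ).aestronglyMeasurable, T.lintegral_L, ENNReal.toReal_ofReal]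
  exact measureReal_nonneg

/-- Second moment bound of the order `c_Δ ^ (2 θ_*) Δ ^ (2 θ_*)`. -/
theorem exists_second_moment_le {b₀ b₁ b₂ B₁ B₂ : ℝ} (hB : T.Admissible b₀ b₁ b₂ B₁ B₂)
    (hu : ∀ x, ContinuousWithinAt (fun θ => T.u θ x) (Set.Iic T.θs) T.θs) (x₀ : S) :
    ∃ R, 0 < R ∧ ∀ᶠ Δ in 𝓝[>] (0 : ℝ),
      MemLp (T.L B₁ B₂ Δ) 2 (T.samplerLaw B₁ B₂ x₀ Δ) ∧
      ∫ ω, T.L B₁ B₂ Δ ω ^ 2 ∂(T.samplerLaw B₁ B₂ x₀ Δ) ≤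
        R * (T.c B₁ B₂ Δ ^ (2 * T.θs) * Δ ^ (2 * T.θs)) := by
  have hU := T.u_pos _ T.root_mem x₀
  refine ⟨Real.exp 1 * (T.u T.θs x₀ * (T.u T.θs x₀ + 1)), by positivity, ?_⟩
  have hρ := tendsto_rho.eventually self_mem_nhdsWithin
  have hρ' : Tendsto rho (𝓝[>] 0) (𝓝 0) := tendsto_rho.mono_right nhdsWithin_le_nhds
  -- Left-continuity at θ_* bounds the moving eigenvector entry by its limit plus 1, which makes the
  -- constant independent of Δ.
  have hV : Tendsto (fun Δ => T.u (T.θs - rho Δ) x₀) (𝓝[>] 0) (𝓝 (T.u T.θs x₀)) := by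
    refine (hu x₀).tendsto.comp (tendsto_nhdsWithin_iff.2 ⟨?_, ?_⟩)
    · simpa using hρ'.const_sub T.θs
    · filter_upwards [hρ] with Δ h
      have h : 0 < rho Δ := h
      exact Set.mem_Iic.2 (by linarith)
  filter_upwards [T.lintegral_L_sq_le hB hu x₀, T.eventually_one_le_c hB.B₁_pos hB.B₂_pos, hρ,
    hρ'.eventually_lt_const T.pos, hV.eventually_lt_const (lt_add_one _),
    Ioo_mem_nhdsGT one_pos] with Δ h1 h2 h3 h4 h5 h6
  have h3 : 0 < rho Δ := h3
  have hV0 := T.u_pos (T.θs - rho Δ) ⟨by linarith, by linarith⟩ x₀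
  have hsq : Integrable (fun ω => T.L B₁ B₂ Δ ω ^ 2) (T.samplerLaw B₁ B₂ x₀ Δ) := by
    refine ⟨((T.measurable_L B₁ B₂ Δ).pow_const 2).aestronglyMeasurable, ?_⟩
    rw [hasFiniteIntegral_iff_ofReal (ae_of_all _ fun ω => sq_nonneg _)]
    exact h1.trans_lt ENNReal.ofReal_lt_top
  refine ⟨(memLp_two_iff_integrable_sq (T.measurable_L B₁ B₂ Δ).aestronglyMeasurable).2 hsq, ?_⟩
  rw [← ofReal_integral_eq_lintegral_ofReal hsq (ae_of_all _ fun ω => sq_nonneg _)] at h1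
  have hc0 : 0 < T.c B₁ B₂ Δ := one_pos.trans_le h2
  have hcp : 0 < T.c B₁ B₂ Δ ^ (2 * T.θs) := Real.rpow_pos_of_pos hc0 _
  have hΔp : 0 < Δ ^ (2 * T.θs) := Real.rpow_pos_of_pos h6.1 _
  refine ((ENNReal.ofReal_le_ofReal_iff ?_).1 h1).trans ?_
  · have := Real.rpow_pos_of_pos hc0 (2 * T.θs - rho Δ)
    have := Real.rpow_pos_of_pos h6.1 (2 * T.θs - rho Δ)
    positivity
  · have e1 : Δ ^ (2 * T.θs - rho Δ) = Δ ^ (2 * T.θs) * Real.exp 1 := by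
      rw [Real.rpow_sub h6.1, rpow_rho h6.1 h6.2, Real.exp_neg, div_inv_eq_mul]
    have e2 : T.c B₁ B₂ Δ ^ (2 * T.θs - rho Δ) ≤ T.c B₁ B₂ Δ ^ (2 * T.θs) :=
      Real.rpow_le_rpow_of_exponent_le h2 (by linarith)
    rw [e1]
    calc _ ≤ T.c B₁ B₂ Δ ^ (2 * T.θs) * (Δ ^ (2 * T.θs) * Real.exp 1)
          * (T.u T.θs x₀ * (T.u T.θs x₀ + 1)) := by gcongr
      _ = _ := by ring

end Cramer

end Perpetuity

end

/-! ### Comparison of the two bounds -/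

theorem mainTheorem3 {S : Type*} [Fintype S] [DecidableEq S] [MeasurableSpace S]
    [MeasurableSingletonClass S] (M : Perpetuity.Model S)
    (hγ : M.DiscountMoments) (T : Perpetuity.Cramer M)
    (hlam : M.RewardMoments) (hlam0 : M.RewardsNontrivial)
    (hu : ∀ x, ContinuousWithinAt (fun θ => T.u θ x) (Set.Iic T.θs) T.θs)
    (b₀ b₁ b₂ B₁ B₂ : ℝ) (hB : T.Admissible b₀ b₁ b₂ B₁ B₂) (x₀ : S) :
    -- unbiasedness
    (∀ Δ : ℝ, 0 < Δ → Δ < 1 → Perpetuity.rho Δ < T.θs →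
      Integrable (T.L B₁ B₂ Δ) (T.samplerLaw B₁ B₂ x₀ Δ) ∧
      ∫ ω, T.L B₁ B₂ Δ ω ∂(T.samplerLaw B₁ B₂ x₀ Δ) = M.φ x₀ Δ) ∧
    -- the coefficient of variation is well defined for small `Δ`
    (∀ᶠ Δ in 𝓝[>] (0 : ℝ),
      0 < M.φ x₀ Δ ∧ MemLp (T.L B₁ B₂ Δ) 2 (T.samplerLaw B₁ B₂ x₀ Δ)) ∧
    -- bounds on the relative second moment and on the coefficient of variation
    ((fun Δ => (∫ ω, T.L B₁ B₂ Δ ω ^ 2 ∂(T.samplerLaw B₁ B₂ x₀ Δ)) / M.φ x₀ Δ ^ 2)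
      =O[𝓝[>] 0] fun Δ => T.c B₁ B₂ Δ ^ (2 * T.θs)) ∧
    ((fun Δ => Perpetuity.coeffVar (T.L B₁ B₂ Δ) (T.samplerLaw B₁ B₂ x₀ Δ))
      =O[𝓝[>] 0] fun Δ => T.c B₁ B₂ Δ ^ (2 * T.θs)) ∧
    -- asymptotic optimality
    (∀ ε : ℝ, 0 < ε →
      (fun Δ => ∫ ω, T.L B₁ B₂ Δ ω ^ 2 ∂(T.samplerLaw B₁ B₂ x₀ Δ))
        =O[𝓝[>] 0] fun Δ => M.φ x₀ Δ ^ (2 - ε)) := by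
  obtain ⟨k, hk, hlow⟩ := T.exists_le_φ hlam0 hB.slope_pos hB.b₁_pos hB.b₁_bound x₀
  obtain ⟨R, hR, hup⟩ := T.exists_second_moment_le hB hu x₀
  have hc1 := T.eventually_one_le_c hB.B₁_pos hB.B₂_pos
  have hpos : ∀ᶠ Δ in 𝓝[>] (0 : ℝ), 0 < M.φ x₀ Δ := by
    filter_upwards [hlow, self_mem_nhdsWithin] with Δ h1 h2
    exact (mul_pos hk (Real.rpow_pos_of_pos h2 _)).trans_le h1
  have hm0 (Δ : ℝ) : 0 ≤ ∫ ω, T.L B₁ B₂ Δ ω ^ 2 ∂(T.samplerLaw B₁ B₂ x₀ Δ) :=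
    integral_nonneg fun ω => sq_nonneg _
  have hratio : ∀ᶠ Δ in 𝓝[>] (0 : ℝ),
      (∫ ω, T.L B₁ B₂ Δ ω ^ 2 ∂(T.samplerLaw B₁ B₂ x₀ Δ)) / M.φ x₀ Δ ^ 2 ≤
        R / k ^ 2 * T.c B₁ B₂ Δ ^ (2 * T.θs) := by
    filter_upwards [hlow, hup, hpos, hc1, self_mem_nhdsWithin] with Δ h1 h2 h3 h4 h5
    have h5 : 0 < Δ := h5
    have hΔ := Real.rpow_pos_of_pos h5 T.θs
    have hcp := Real.rpow_pos_of_pos (one_pos.trans_le h4) (2 * T.θs)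
    have e : Δ ^ (2 * T.θs) = (Δ ^ T.θs) ^ 2 := by
      rw [mul_comm, Real.rpow_mul h5.le, Real.rpow_two]
    rw [div_le_iff₀ (by positivity)]
    calc _ ≤ R * (T.c B₁ B₂ Δ ^ (2 * T.θs) * Δ ^ (2 * T.θs)) := h2.2
      _ = R / k ^ 2 * T.c B₁ B₂ Δ ^ (2 * T.θs) * (k * Δ ^ T.θs) ^ 2 := by
        rw [e]; field_simp
      _ ≤ _ := by gcongr
  refine ⟨fun Δ _ _ _ => ⟨T.integrable_L B₁ B₂ Δ x₀, T.integral_L B₁ B₂ Δ x₀⟩, ?_, ?_, ?_, ?_⟩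
  · filter_upwards [hpos, hup] with Δ h1 h2 using ⟨h1, h2.1⟩
  · refine IsBigO.of_bound (R / k ^ 2) ?_
    filter_upwards [hratio, hc1] with Δ h1 h2
    rw [Real.norm_of_nonneg (div_nonneg (hm0 Δ) (sq_nonneg _)),
      Real.norm_of_nonneg (Real.rpow_nonneg (zero_le_one.trans h2) _)]
    exact h1
  · refine IsBigO.of_bound (1 + R / k ^ 2) ?_
    filter_upwards [hratio, hc1, hpos] with Δ h1 h2 h3
    have hcp : 1 ≤ T.c B₁ B₂ Δ ^ (2 * T.θs) := Real.one_le_rpow h2 (by linarith [T.pos])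
    rw [Perpetuity.coeffVar, T.integral_L, Real.norm_of_nonneg (by positivity),
      Real.norm_of_nonneg (by positivity)]
    have hvar := variance_le_expectation_sq (μ := T.samplerLaw B₁ B₂ x₀ Δ)
      (T.measurable_L B₁ B₂ Δ).aestronglyMeasurable
    set m := ∫ ω, T.L B₁ B₂ Δ ω ^ 2 ∂(T.samplerLaw B₁ B₂ x₀ Δ)
    calc _ ≤ Real.sqrt m / M.φ x₀ Δ := by
          gcongr
          exact hvar
      _ = Real.sqrt (m / M.φ x₀ Δ ^ 2) := by
          rw [Real.sqrt_div' _ (sq_nonneg _), Real.sqrt_sq h3.le]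
      -- √y ≤ 1 + y for y ≥ 0; the 1 is then absorbed by c^{2θ_*} ≥ 1.
      _ ≤ 1 + m / M.φ x₀ Δ ^ 2 := by
          have : 0 ≤ m / M.φ x₀ Δ ^ 2 := div_nonneg (hm0 Δ) (sq_nonneg _)
          rw [Real.sqrt_le_left (by linarith)]
          nlinarith
      _ ≤ T.c B₁ B₂ Δ ^ (2 * T.θs) + R / k ^ 2 * T.c B₁ B₂ Δ ^ (2 * T.θs) := add_le_add hcp h1
      _ = _ := by ring
  · intro ε hε
    -- Capping ε at 2 keeps the exponent of φ non-negative, so that the lower bound on φ can be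
    -- raised to it. The return to ε uses φ ≤ 1.
    have hε' : 0 < min ε 2 := lt_min hε two_pos
    have h1 : (fun Δ => ∫ ω, T.L B₁ B₂ Δ ω ^ 2 ∂(T.samplerLaw B₁ B₂ x₀ Δ)) =O[𝓝[>] 0]
        fun Δ => T.c B₁ B₂ Δ ^ (2 * T.θs) * Δ ^ (2 * T.θs) := by
      refine IsBigO.of_bound R ?_
      filter_upwards [hup, hc1, self_mem_nhdsWithin] with Δ h1 h2 h3
      rw [Real.norm_of_nonneg (hm0 Δ), Real.norm_of_nonneg (mul_nonneg
        (Real.rpow_nonneg (zero_le_one.trans h2) _) (Real.rpow_nonneg (le_of_lt h3) _))]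
      exact h1.2
    -- The exponent b = θ_* min(ε, 2) is chosen so that Δ^{2θ_* − b} is (Δ^{θ_*})^{2 − min(ε, 2)}.
    have h2 := (T.c_rpow_isBigO hB.B₁_pos hB.B₂_pos (mul_pos T.pos hε')).mul
      (isBigO_refl (fun Δ : ℝ => Δ ^ (2 * T.θs)) (𝓝[>] 0))
    refine (h1.trans h2).trans (IsBigO.of_bound (k ^ (2 - min ε 2))⁻¹ ?_)
    filter_upwards [hlow, hpos, self_mem_nhdsWithin] with Δ h3 h4 h5
    have h5 : 0 < Δ := h5
    have hkp := Real.rpow_pos_of_pos hk (2 - min ε 2)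
    rw [← Real.rpow_add h5, Real.norm_of_nonneg (Real.rpow_nonneg h5.le _),
      Real.norm_of_nonneg (Real.rpow_nonneg h4.le _), le_inv_mul_iff₀ hkp]
    calc k ^ (2 - min ε 2) * Δ ^ (-(T.θs * min ε 2) + 2 * T.θs)
        = (k * Δ ^ T.θs) ^ (2 - min ε 2) := by
          rw [Real.mul_rpow hk.le (Real.rpow_nonneg h5.le _), ← Real.rpow_mul h5.le]
          ring_nf
      _ ≤ M.φ x₀ Δ ^ (2 - min ε 2) :=
          Real.rpow_le_rpow (mul_nonneg hk.le (Real.rpow_nonneg h5.le _)) h3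
            (sub_nonneg.2 (min_le_right _ _))
      _ ≤ M.φ x₀ Δ ^ (2 - ε) :=
          Real.rpow_le_rpow_of_exponent_ge h4 (measureReal_le_one)
            (by linarith [min_le_left ε 2])
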